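/- Throughout, rings are associative and not necessarily unital. Let $R\subseteq S$ be an extension of rings with the same set of local units $\mathsf{E}$: $\mathsf{E}\subseteq R$ is a set of idempotents such that for every finite subset $F$ of $S$ there is $e\in\mathsf{E}$ with $es=se=s$ for all $s\in F$. For $s\in S$ put $Unit\{s\}=\{e\in\mathsf{E}\mid es=se=s\}$. A bimodule $M$ over a ring $A$ is unital if $AM=M=MA$. Notation. - $\mathrm{Aut}_{S\text{-}R}(S)$ is the group of $S$-$R$-bilinear automorphisms of $S$, and $\mathrm{Aut}_{R\text{-rings}}(S)$ is the group of ring automorphisms of $S$ that act as the identity on $R$ (both under composition). - $\mathrm{Inv}_R(S)$ is the group, with neutral element $R$, of the unital $R$-subbimodules $X$ of $S$ for which there is an $R$-subbimodule $Y$ of $S$ with $XY=YX=R$. - For a ring $A$ with local units, $\mathrm{Pic}(A)$ is the group of isomorphism classes $[P]$ of unital $A$-bimodules $P$ for which there is a unital $A$-bimodule $Q$ with $P\otimes_AQ\cong A\cong Q\otimes_AP$ as bimodules. The product is induced by $\otimes_A$ and the neutral element is $[A]$. - $\mathcal{M}(S/R)$ is the category whose objects $(P\overset{\phi}{\Rightarrow}X)$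 consist of a unital $R$-bimodule $P$, a unital $S$-bimodule $X$ and an $R$-bilinear map $\phi:P\to X$ such that $P\otimes_RS\to X$, $p\otimes s\mapsto\phi(p)s$, and $S\otimes_RP\to X$, $s\otimes p\mapsto s\phi(p)$, are bijective. Its morphisms are pairs $(\alpha,\beta)$ with $\alpha$ $R$-bilinear, $\beta$ $S$-bilinear and $\beta\phi=\phi'\alpha$. Its isomorphism classes form a monoid $\mathcal{S}(S/R)$, in which the product of the classes of $(P\overset{\phi}{\Rightarrow}X)$ and $(Q\overset{\psi}{\Rightarrow}Y)$ is the class of $P\otimes_RQ\Rightarrow X\otimes_SY$, $p\otimes q\mapsto\phi(p)\otimes\psi(q)$, and the neutral element is the class of the inclusion $R\Rightarrow S$. $\mathcal{P}(S/R)$ is the submonoid of the classes of those $(P\overset{\phi}{\Rightarrow}X)$ with $[P]\in\mathrm{Pic}(R)$ and $[X]\in\mathrm{Pic}(S)$. - For $\gamma\in\mathrm{Aut}_{R\text{-rings}}(S)$, $S_\gamma$ is the $S$-bimodule with underlying group $S$ and actions $t\cdot x=tx$, $x\cdot t=x\gamma(t)$, and $\iota_\gamma:R\to S_\gamma$ is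 the inclusion. Statement. The monoid $\mathcal{P}(S/R)$ is a group, and the following are well-defined homomorphisms of groups: $$\mathscr{D}:\mathrm{Aut}_{S\text{-}R}(S)\to\mathrm{Inv}_R(S),\ \lambda\mapsto\lambda^{-1}(R);\qquad \widehat{(-)}:\mathrm{Aut}_{S\text{-}R}(S)\to\mathrm{Aut}_{R\text{-rings}}(S),\ \widehat{\lambda}(s)=\lambda^{-1}(e)\,s\,\lambda(e)\ \text{ for every } e\in Unit\{s\};$$ $$\mathscr{E}:\mathrm{Aut}_{R\text{-rings}}(S)\to\mathcal{P}(S/R),\ \gamma\mapsto[R\overset{\iota_\gamma}{\Rightarrow}S_\gamma];\qquad \mathscr{O}_l:\mathcal{P}(S/R)\to\mathrm{Pic}(R),\ [P\overset{\phi}{\Rightarrow}X]\mapsto[P].$$ Moreover, the sequence of groups $$1\to\mathrm{Ker}(\mathscr{D})\cap\mathrm{Ker}\,\widehat{(-)}\to\mathrm{Ker}(\mathscr{D})\to\mathrm{Aut}_{R\text{-rings}}(S)\overset{\mathscr{E}}{\to}\mathcal{P}(S/R)\overset{\mathscr{O}_l}{\to}\mathrm{Pic}(R)$$ is exact, where the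 first map is the inclusion and the second is the restriction of $\widehat{(-)}$ to $\mathrm{Ker}(\mathscr{D})$. -/

import Mathlib

open scoped TensorProduct

universe u

namespace LURing

/-! ### Rings with local units -/

/-- A (not necessarily unital) ring `A` with a fixed set `E` of local units. -/
class LocalUnits (A : Type u) [NonUnitalRing A] where
  E : Set A
  idem : ∀ e ∈ E, e * e = e
  exists_unit : ∀ F : Finset A, ∃ e ∈ E, ∀ x ∈ F, e * x = x ∧ x * e = x

/-- `R ⊆ S` is an extension with the same set of local units: the local units of `S` lie in `R`. -/
class SameLocalUnits {S : Type u} [NonUnitalRing S] [LocalUnits S] (R : NonUnitalSubring S) :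
    Prop where
  mem : ∀ e ∈ LocalUnits.E (A := S), e ∈ R

instance {S : Type u} [NonUnitalRing S] [LocalUnits S] (R : NonUnitalSubring S)
    [SameLocalUnits R] : LocalUnits R where
  E := {e | (e : S) ∈ LocalUnits.E (A := S)}
  idem e he := Subtype.ext (LocalUnits.idem _ he)
  exists_unit F := by
    classical
    obtain ⟨e, he, h⟩ := LocalUnits.exists_unit (F.image (fun x : R => (x : S)))
    refine ⟨⟨e, SameLocalUnits.mem e he⟩, he, fun x hx => ?_⟩
    have := h x (Finset.mem_image_of_mem _ hx)
    exact ⟨Subtype.ext this.1, Subtype.ext this.2⟩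

/-- The set `Unit{s}` of the `e ∈ E` with `e s = s e = s`. -/
def unitsOf {A : Type u} [NonUnitalRing A] [LocalUnits A] (s : A) : Set A :=
  {e | e ∈ LocalUnits.E (A := A) ∧ e * s = s ∧ s * e = s}

section units
variable {A : Type u} [NonUnitalRing A] [LocalUnits A]

theorem exists_unit₁ (a : A) : ∃ e : A, e * a = a ∧ a * e = a := by
  obtain ⟨e, -, h⟩ := LocalUnits.exists_unit ({a} : Finset A)
  exact ⟨e, h a (by simp)⟩

theorem exists_unit₂ (a b : A) :
    ∃ e : A, (e * a = a ∧ a * e = a) ∧ (e * b = b ∧ b * e = b) := by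
  classical
  obtain ⟨e, -, h⟩ := LocalUnits.exists_unit ({a, b} : Finset A)
  exact ⟨e, h a (by simp), h b (by simp)⟩

end units

/-! ### Unital bimodules -/

/-- A unital `A`-`B`-bimodule: an abelian group with biadditive actions
`l a x = a x` and `r b x = x b`, such that `A M = M` and `M B = M`. -/
structure Bimod (A B : Type u) [NonUnitalRing A] [NonUnitalRing B] : Type (u + 1) where
  carrier : Type u
  [grp : AddCommGroup carrier]
  l : A →+ carrier →+ carrier
  r : B →+ carrier →+ carrier
  l_mul : ∀ a a' x, l (a * a') x = l a (l a' x)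
  r_mul : ∀ b b' x, r (b * b') x = r b' (r b x)
  l_r : ∀ a b x, l a (r b x) = r b (l a x)
  unital_l : ∀ x, x ∈ AddSubgroup.closure {y | ∃ a z, y = l a z}
  unital_r : ∀ x, x ∈ AddSubgroup.closure {y | ∃ b z, y = r b z}

attribute [instance] Bimod.grp

instance (A B : Type u) [NonUnitalRing A] [NonUnitalRing B] :
    CoeSort (Bimod A B) (Type u) := ⟨Bimod.carrier⟩

section
variable {A B C D : Type u} [NonUnitalRing A] [NonUnitalRing B] [NonUnitalRing C]
  [NonUnitalRing D]

/-- An additive map between bimodules is bilinear. -/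
structure IsBilinear {M N : Bimod A B} (f : M →+ N) : Prop where
  map_l : ∀ a x, f (M.l a x) = N.l a (f x)
  map_r : ∀ b x, f (M.r b x) = N.r b (f x)

/-- Two bimodules are isomorphic. -/
def Iso (M N : Bimod A B) : Prop :=
  ∃ f : M →+ N, IsBilinear f ∧ Function.Bijective f

theorem IsBilinear.id (M : Bimod A B) : IsBilinear (AddMonoidHom.id M) :=
  ⟨fun _ _ => rfl, fun _ _ => rfl⟩

theorem IsBilinear.comp {M N K : Bimod A B} {g : N →+ K} {f : M →+ N}
    (hg : IsBilinear g) (hf : IsBilinear f) : IsBilinear (g.comp f) :=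
  ⟨fun a x => by simp [hf.map_l, hg.map_l], fun a x => by simp [hf.map_r, hg.map_r]⟩

theorem IsBilinear.exists_inv {M N : Bimod A B} {f : M →+ N} (hf : IsBilinear f)
    (hb : Function.Bijective f) : ∃ g : N →+ M, IsBilinear g ∧ Function.Bijective g ∧
      (∀ x, g (f x) = x) ∧ (∀ y, f (g y) = y) := by
  let e := AddEquiv.ofBijective f hb
  have h1 : ∀ x, e.symm (f x) = x := fun x => e.symm_apply_apply x
  have h2 : ∀ y, f (e.symm y) = y := fun y => e.apply_symm_apply y
  refine ⟨e.symm.toAddMonoidHom, ⟨fun a x => ?_, fun a x => ?_⟩, e.symm.bijective, h1, h2⟩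
  · apply hb.1
    change f (e.symm _) = f (M.l a (e.symm x))
    rw [h2, hf.map_l, h2]
  · apply hb.1
    change f (e.symm _) = f (M.r a (e.symm x))
    rw [h2, hf.map_r, h2]

theorem Iso.refl (M : Bimod A B) : Iso M M :=
  ⟨AddMonoidHom.id M, IsBilinear.id M, Function.bijective_id⟩

theorem Iso.symm {M N : Bimod A B} : Iso M N → Iso N M := by
  rintro ⟨f, hf, hb⟩
  obtain ⟨g, hg, hgb, -⟩ := hf.exists_inv hb
  exact ⟨g, hg, hgb⟩

theorem Iso.trans {M N K : Bimod A B} : Iso M N → Iso N K → Iso M K := by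
  rintro ⟨f, hf, hb⟩ ⟨g, hg, hb'⟩
  exact ⟨g.comp f, hg.comp hf, hb'.comp hb⟩

/-! ### Tensor product over a ring with local units -/

/-- The subgroup of `M ⊗[ℤ] N` generated by the elements `(m b) ⊗ n - m ⊗ (b n)`. -/
def tensorRel (M : Bimod A B) (N : Bimod B C) : AddSubgroup (M ⊗[ℤ] N) :=
  AddSubgroup.closure {z | ∃ m b n, z = (M.r b m) ⊗ₜ[ℤ] n - m ⊗ₜ[ℤ] (N.l b n)}

/-- The abelian group `M ⊗_B N`. -/
def Tens (M : Bimod A B) (N : Bimod B C) : Type u := (M ⊗[ℤ] N) ⧸ tensorRel M N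

instance (M : Bimod A B) (N : Bimod B C) : AddCommGroup (Tens M N) :=
  inferInstanceAs (AddCommGroup ((M ⊗[ℤ] N) ⧸ tensorRel M N))

/-- The universal balanced map `(m, n) ↦ m ⊗ n`. -/
def tmul (M : Bimod A B) (N : Bimod B C) : M →+ N →+ Tens M N :=
  AddMonoidHom.mk' (fun m => AddMonoidHom.mk'
    (fun n => QuotientAddGroup.mk' (tensorRel M N) (m ⊗ₜ[ℤ] n))
    (fun n n' => by rw [TensorProduct.tmul_add, map_add]; rfl))
    (fun m m' => by
      ext n
      exact (congrArg (QuotientAddGroup.mk' (tensorRel M N)) (TensorProduct.add_tmul m m' n)).trans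
        (map_add (QuotientAddGroup.mk' (tensorRel M N)) _ _))

theorem tmul_bal (M : Bimod A B) (N : Bimod B C) (m : M) (b : B) (n : N) :
    tmul M N (M.r b m) n = tmul M N m (N.l b n) := by
  refine (QuotientAddGroup.eq_iff_sub_mem).2 (AddSubgroup.subset_closure ⟨m, b, n, rfl⟩)

/-- The additive map on `M ⊗_B N` induced by a `B`-balanced biadditive map. -/
def tlift (M : Bimod A B) (N : Bimod B C) {G : Type*} [AddCommGroup G] (f : M →+ N →+ G)
    (hf : ∀ m b n, f (M.r b m) n = f m (N.l b n)) : Tens M N →+ G :=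
  QuotientAddGroup.lift (tensorRel M N)
    (TensorProduct.liftAddHom (R := ℤ) f (fun k m n => by simp))
    ((AddSubgroup.closure_le _).2 (by
      rintro _ ⟨m, b, n, rfl⟩
      change _ = _
      rw [map_sub, TensorProduct.liftAddHom_tmul, TensorProduct.liftAddHom_tmul, hf, sub_self]))

@[simp] theorem tlift_tmul (M : Bimod A B) (N : Bimod B C) {G : Type*} [AddCommGroup G]
    (f : M →+ N →+ G) (hf) (m : M) (n : N) : tlift M N f hf (tmul M N m n) = f m n := rfl

theorem tens_induction {M : Bimod A B} {N : Bimod B C} {p : Tens M N → Prop}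
    (z : Tens M N) (h0 : p 0) (ht : ∀ m n, p (tmul M N m n))
    (ha : ∀ x y, p x → p y → p (x + y)) : p z := by
  obtain ⟨z, rfl⟩ := QuotientAddGroup.mk'_surjective (tensorRel M N) z
  induction z using TensorProduct.induction_on with
  | zero => exact h0
  | tmul m n => exact ht m n
  | add x y hx hy => rw [map_add]; exact ha _ _ hx hy

theorem tens_congr {M : Bimod A B} {N : Bimod B C} {G : Type*} [AddCommGroup G]
    {f g : Tens M N →+ G} (h : ∀ m n, f (tmul M N m n) = g (tmul M N m n)) (z : Tens M N) :
    f z = g z := by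
  induction z using tens_induction with
  | h0 => rw [map_zero, map_zero]
  | ht m n => exact h m n
  | ha x y hx hy => rw [map_add, map_add, hx, hy]

theorem tens_hom_ext {M : Bimod A B} {N : Bimod B C} {G : Type*} [AddCommGroup G]
    {f g : Tens M N →+ G} (h : ∀ m n, f (tmul M N m n) = g (tmul M N m n)) : f = g :=
  AddMonoidHom.ext (tens_congr h)

/-- The map `f ⊗ g` for `f` right linear and `g` left linear. -/
def tmap (M : Bimod A B) (N : Bimod B C) {A' C' : Type u} [NonUnitalRing A'] [NonUnitalRing C']
    (M' : Bimod A' B) (N' : Bimod B C') (f : M →+ M') (g : N →+ N')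
    (hf : ∀ b m, f (M.r b m) = M'.r b (f m)) (hg : ∀ b n, g (N.l b n) = N'.l b (g n)) :
    Tens M N →+ Tens M' N' :=
  tlift M N (((AddMonoidHom.compHom' g).comp (tmul M' N')).comp f) (fun m b n => by
    change tmul M' N' (f _) (g _) = tmul M' N' (f _) (g _)
    rw [hf, hg, tmul_bal])

@[simp] theorem tmap_tmul (M : Bimod A B) (N : Bimod B C) {A' C' : Type u} [NonUnitalRing A']
    [NonUnitalRing C'] (M' : Bimod A' B) (N' : Bimod B C') (f : M →+ M') (g : N →+ N') (hf) (hg)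
    (m : M) (n : N) : tmap M N M' N' f g hf hg (tmul M N m n) = tmul M' N' (f m) (g n) := rfl

theorem tmap_bijective (M : Bimod A B) (N : Bimod B C) {A' C' : Type u} [NonUnitalRing A']
    [NonUnitalRing C'] (M' : Bimod A' B) (N' : Bimod B C') (f : M →+ M') (g : N →+ N') (hf) (hg)
    (hfb : Function.Bijective f) (hgb : Function.Bijective g) :
    Function.Bijective (tmap M N M' N' f g hf hg) := by
  let e := AddEquiv.ofBijective f hfb
  let e' := AddEquiv.ofBijective g hgb
  have h1 : ∀ x, e.symm (f x) = x := fun x => e.symm_apply_apply x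
  have h2 : ∀ y, f (e.symm y) = y := fun y => e.apply_symm_apply y
  have h1' : ∀ x, e'.symm (g x) = x := fun x => e'.symm_apply_apply x
  have h2' : ∀ y, g (e'.symm y) = y := fun y => e'.apply_symm_apply y
  let k : Tens M' N' →+ Tens M N := tmap M' N' M N e.symm.toAddMonoidHom e'.symm.toAddMonoidHom
    (fun b m => hfb.1 (by
      change f (e.symm _) = f (M.r b (e.symm m)); rw [h2, hf, h2]))
    (fun b m => hgb.1 (by
      change g (e'.symm _) = g (N.l b (e'.symm m)); rw [h2', hg, h2']))
  refine Function.bijective_iff_has_inverse.2 ⟨k, fun z => ?_, fun z => ?_⟩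
  · exact DFunLike.congr_fun (f := k.comp (tmap M N M' N' f g hf hg)) (g := AddMonoidHom.id _)
      (tens_hom_ext fun m n => by
        change tmul M N (e.symm (f m)) (e'.symm (g n)) = tmul M N m n
        rw [h1, h1']) z
  · exact DFunLike.congr_fun (f := (tmap M N M' N' f g hf hg).comp k) (g := AddMonoidHom.id _)
      (tens_hom_ext fun m n => by
        change tmul M' N' (f (e.symm m)) (g (e'.symm n)) = tmul M' N' m n
        rw [h2, h2']) z

/-- The action of `a` on `M ⊗_B N`. -/
def tensL (M : Bimod A B) (N : Bimod B C) (a : A) : Tens M N →+ Tens M N :=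
  tmap M N M N (M.l a) (AddMonoidHom.id N) (fun b m => M.l_r a b m) (fun _ _ => rfl)

/-- The action of `c` on `M ⊗_B N`. -/
def tensR (M : Bimod A B) (N : Bimod B C) (c : C) : Tens M N →+ Tens M N :=
  tmap M N M N (AddMonoidHom.id M) (N.r c) (fun _ _ => rfl) (fun b n => (N.l_r b c n).symm)

@[simp] theorem tensL_tmul (M : Bimod A B) (N : Bimod B C) (a : A) (m : M) (n : N) :
    tensL M N a (tmul M N m n) = tmul M N (M.l a m) n := rfl

@[simp] theorem tensR_tmul (M : Bimod A B) (N : Bimod B C) (c : C) (m : M) (n : N) :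
    tensR M N c (tmul M N m n) = tmul M N m (N.r c n) := rfl

/-- The `A`-`C`-bimodule `M ⊗_B N`. -/
abbrev tensor (M : Bimod A B) (N : Bimod B C) : Bimod A C where
  carrier := Tens M N
  l := AddMonoidHom.mk' (tensL M N) (fun a a' => tens_hom_ext fun m n => by
    simp only [AddMonoidHom.add_apply, tensL_tmul, map_add])
  r := AddMonoidHom.mk' (tensR M N) (fun a a' => tens_hom_ext fun m n => by
    simp only [AddMonoidHom.add_apply, tensR_tmul, map_add])
  l_mul a a' x := DFunLike.congr_fun (f := tensL M N (a * a'))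
    (g := (tensL M N a).comp (tensL M N a')) (tens_hom_ext fun m n => by
      simp only [AddMonoidHom.comp_apply, tensL_tmul, M.l_mul]) x
  r_mul a a' x := DFunLike.congr_fun (f := tensR M N (a * a'))
    (g := (tensR M N a').comp (tensR M N a)) (tens_hom_ext fun m n => by
      simp only [AddMonoidHom.comp_apply, tensR_tmul, N.r_mul]) x
  l_r a c x := DFunLike.congr_fun (f := (tensL M N a).comp (tensR M N c))
    (g := (tensR M N c).comp (tensL M N a)) (tens_hom_ext fun m n => by
      simp only [AddMonoidHom.comp_apply, tensL_tmul, tensR_tmul]) x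
  unital_l x := by
    refine tens_induction x (zero_mem _) (fun m n => ?_) (fun x y => add_mem)
    induction M.unital_l m using AddSubgroup.closure_induction with
    | mem m hm =>
      obtain ⟨a, m, rfl⟩ := hm
      exact AddSubgroup.subset_closure ⟨a, tmul M N m n, rfl⟩
    | zero => rw [map_zero]; exact zero_mem _
    | add x y _ _ hx hy => rw [map_add]; exact add_mem hx hy
    | neg x _ hx => rw [map_neg]; exact neg_mem hx
  unital_r x := by
    refine tens_induction x (zero_mem _) (fun m n => ?_) (fun x y => add_mem)
    induction N.unital_r n using AddSubgroup.closure_induction with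
    | mem n hn =>
      obtain ⟨a, n, rfl⟩ := hn
      exact AddSubgroup.subset_closure ⟨a, tmul M N m n, rfl⟩
    | zero => rw [map_zero]; exact zero_mem _
    | add x y _ _ hx hy => rw [map_add]; exact add_mem hx hy
    | neg x _ hx => rw [map_neg]; exact neg_mem hx

@[simp] theorem tensor_l_tmul (M : Bimod A B) (N : Bimod B C) (a : A) (m : M) (n : N) :
    (tensor M N).l a (tmul M N m n) = tmul M N (M.l a m) n := rfl

@[simp] theorem tensor_r_tmul (M : Bimod A B) (N : Bimod B C) (c : C) (m : M) (n : N) :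
    (tensor M N).r c (tmul M N m n) = tmul M N m (N.r c n) := rfl

/-- A map out of a tensor product is bilinear if it is so on pure tensors. -/
theorem isBilinear_of_tmul {M : Bimod A B} {N : Bimod B C} {K : Bimod A C}
    (f : tensor M N →+ K)
    (hl : ∀ a m n, f (tmul M N (M.l a m) n) = K.l a (f (tmul M N m n)))
    (hr : ∀ c m n, f (tmul M N m (N.r c n)) = K.r c (f (tmul M N m n))) : IsBilinear f := by
  constructor
  · intro a x
    exact DFunLike.congr_fun (f := f.comp ((tensor M N).l a)) (g := (K.l a).comp f)
      (tens_hom_ext fun m n => hl a m n) x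
  · intro a x
    exact DFunLike.congr_fun (f := f.comp ((tensor M N).r a)) (g := (K.r a).comp f)
      (tens_hom_ext fun m n => hr a m n) x

theorem tmap_isBilinear {M M' : Bimod A B} {N N' : Bimod B C} {f : M →+ M'} {g : N →+ N'}
    (hf : IsBilinear f) (hg : IsBilinear g) :
    IsBilinear (M := tensor M N) (N := tensor M' N')
      (tmap M N M' N' f g hf.map_r hg.map_l) := by
  refine isBilinear_of_tmul (M := M) (N := N) (K := tensor M' N') _
    (fun a m n => ?_) (fun c m n => ?_)
  · exact congrArg (fun t => tmul M' N' t (g n)) (hf.map_l a m)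
  · exact congrArg (tmul M' N' (f m)) (hg.map_r c n)

theorem Iso.tensor {M M' : Bimod A B} {N N' : Bimod B C} (h : Iso M M') (h' : Iso N N') :
    Iso (tensor M N) (tensor M' N') := by
  obtain ⟨f, hf, hfb⟩ := h
  obtain ⟨g, hg, hgb⟩ := h'
  exact ⟨tmap M N M' N' f g hf.map_r hg.map_l, tmap_isBilinear hf hg,
    tmap_bijective _ _ _ _ _ _ _ _ hfb hgb⟩

/-- The associativity map `(M ⊗ N) ⊗ K → M ⊗ (N ⊗ K)`. -/
def assocHom (M : Bimod A B) (N : Bimod B C) (K : Bimod C D) :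
    tensor (tensor M N) K →+ tensor M (tensor N K) :=
  tlift (tensor M N) K
    (tlift M N
      (AddMonoidHom.mk' (fun m => (AddMonoidHom.compHom (tmul M (tensor N K) m)).comp (tmul N K))
        (fun m m' => by ext n k; exact DFunLike.congr_fun (map_add (tmul M (tensor N K)) m m') _))
      (fun m b n => by ext k; exact tmul_bal M (tensor N K) m b (tmul N K n k)))
    (fun z c k => by
      induction z using tens_induction with
      | h0 => simp only [map_zero, AddMonoidHom.zero_apply]
      | ht m n => exact congrArg (tmul M (tensor N K) m) (tmul_bal N K n c k)
      | ha x y hx hy => simp only [map_add, AddMonoidHom.add_apply, hx, hy])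

/-- The associativity map `M ⊗ (N ⊗ K) → (M ⊗ N) ⊗ K`. -/
def assocInv (M : Bimod A B) (N : Bimod B C) (K : Bimod C D) :
    tensor M (tensor N K) →+ tensor (tensor M N) K :=
  tlift M (tensor N K)
    (AddMonoidHom.mk' (fun m => tlift N K ((tmul (tensor M N) K).comp (tmul M N m))
        (fun n c k => tmul_bal (tensor M N) K (tmul M N m n) c k))
      (fun m m' => tens_hom_ext fun n k => by
        change tmul (tensor M N) K (tmul M N (m + m') n) k = tmul (tensor M N) K (tmul M N m n) k
          + tmul (tensor M N) K (tmul M N m' n) k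
        rw [map_add, AddMonoidHom.add_apply, map_add, AddMonoidHom.add_apply]))
    (fun m b z => by
      induction z using tens_induction with
      | h0 => simp only [map_zero]
      | ht n k => exact congrArg (fun t => tmul (tensor M N) K t k) (tmul_bal M N m b n)
      | ha x y hx hy => simp only [map_add, hx, hy])

@[simp] theorem assocHom_tmul (M : Bimod A B) (N : Bimod B C) (K : Bimod C D) (m n k) :
    assocHom M N K (tmul (tensor M N) K (tmul M N m n) k)
      = tmul M (tensor N K) m (tmul N K n k) := rfl

@[simp] theorem assocInv_tmul (M : Bimod A B) (N : Bimod B C) (K : Bimod C D) (m n k) :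
    assocInv M N K (tmul M (tensor N K) m (tmul N K n k))
      = tmul (tensor M N) K (tmul M N m n) k := rfl

theorem tens₃_hom_ext {M : Bimod A B} {N : Bimod B C} {K : Bimod C D} {G : Type*}
    [AddCommGroup G] {f g : tensor (tensor M N) K →+ G}
    (h : ∀ m n k, f (tmul (tensor M N) K (tmul M N m n) k)
      = g (tmul (tensor M N) K (tmul M N m n) k)) : f = g :=
  tens_hom_ext fun z k => by
    induction z using tens_induction with
    | h0 => simp only [map_zero, AddMonoidHom.zero_apply]
    | ht m n => exact h m n k
    | ha x y hx hy => simp only [map_add, AddMonoidHom.add_apply, hx, hy]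

theorem tens₃_hom_ext' {M : Bimod A B} {N : Bimod B C} {K : Bimod C D} {G : Type*}
    [AddCommGroup G] {f g : tensor M (tensor N K) →+ G}
    (h : ∀ m n k, f (tmul M (tensor N K) m (tmul N K n k))
      = g (tmul M (tensor N K) m (tmul N K n k))) : f = g :=
  tens_hom_ext fun m z => by
    induction z using tens_induction with
    | h0 => simp only [map_zero]
    | ht n k => exact h m n k
    | ha x y hx hy => simp only [map_add, hx, hy]

theorem assocHom_bijective (M : Bimod A B) (N : Bimod B C) (K : Bimod C D) :
    Function.Bijective (assocHom M N K) :=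
  Function.bijective_iff_has_inverse.2 ⟨assocInv M N K,
    fun z => DFunLike.congr_fun (f := (assocInv M N K).comp (assocHom M N K))
      (g := AddMonoidHom.id _) (tens₃_hom_ext fun _ _ _ => rfl) z,
    fun z => DFunLike.congr_fun (f := (assocHom M N K).comp (assocInv M N K))
      (g := AddMonoidHom.id _) (tens₃_hom_ext' fun _ _ _ => rfl) z⟩

theorem assocHom_isBilinear (M : Bimod A B) (N : Bimod B C) (K : Bimod C D) :
    IsBilinear (assocHom M N K) := by
  constructor
  · intro a x
    exact DFunLike.congr_fun (f := (assocHom M N K).comp ((tensor (tensor M N) K).l a))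
      (g := ((tensor M (tensor N K)).l a).comp (assocHom M N K))
      (tens₃_hom_ext fun _ _ _ => rfl) x
  · intro a x
    exact DFunLike.congr_fun (f := (assocHom M N K).comp ((tensor (tensor M N) K).r a))
      (g := ((tensor M (tensor N K)).r a).comp (assocHom M N K))
      (tens₃_hom_ext fun _ _ _ => rfl) x

/-! ### Unit laws -/

theorem exists_l_unit [LocalUnits A] (M : Bimod A B) (x : M) : ∃ e : A, M.l e x = x := by
  suffices h : ∃ e₀ : A, ∀ e, e * e₀ = e₀ → M.l e x = x by
    obtain ⟨e₀, h⟩ := h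
    obtain ⟨e, he, -⟩ := exists_unit₁ e₀
    exact ⟨e, h e he⟩
  induction M.unital_l x using AddSubgroup.closure_induction with
  | mem x hx =>
    obtain ⟨a, z, rfl⟩ := hx
    exact ⟨a, fun e he => by rw [← M.l_mul, he]⟩
  | zero => exact ⟨0, fun e _ => map_zero _⟩
  | add x y _ _ hx hy =>
    obtain ⟨e₁, h₁⟩ := hx
    obtain ⟨e₂, h₂⟩ := hy
    obtain ⟨f, ⟨hf₁, -⟩, ⟨hf₂, -⟩⟩ := exists_unit₂ e₁ e₂
    refine ⟨f, fun e he => ?_⟩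
    rw [map_add, h₁ e (by rw [← hf₁, ← mul_assoc, he]), h₂ e (by rw [← hf₂, ← mul_assoc, he])]
  | neg x _ hx =>
    obtain ⟨e₁, h₁⟩ := hx
    exact ⟨e₁, fun e he => by rw [map_neg, h₁ e he]⟩

theorem exists_r_unit [LocalUnits B] (M : Bimod A B) (x : M) : ∃ e : B, M.r e x = x := by
  suffices h : ∃ e₀ : B, ∀ e, e₀ * e = e₀ → M.r e x = x by
    obtain ⟨e₀, h⟩ := h
    obtain ⟨e, -, he⟩ := exists_unit₁ e₀
    exact ⟨e, h e he⟩
  induction M.unital_r x using AddSubgroup.closure_induction with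
  | mem x hx =>
    obtain ⟨a, z, rfl⟩ := hx
    exact ⟨a, fun e he => by rw [← M.r_mul, he]⟩
  | zero => exact ⟨0, fun e _ => map_zero _⟩
  | add x y _ _ hx hy =>
    obtain ⟨e₁, h₁⟩ := hx
    obtain ⟨e₂, h₂⟩ := hy
    obtain ⟨f, ⟨-, hf₁⟩, ⟨-, hf₂⟩⟩ := exists_unit₂ e₁ e₂
    refine ⟨f, fun e he => ?_⟩
    rw [map_add, h₁ e (by rw [← hf₁, mul_assoc, he]), h₂ e (by rw [← hf₂, mul_assoc, he])]
  | neg x _ hx =>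
    obtain ⟨e₁, h₁⟩ := hx
    exact ⟨e₁, fun e he => by rw [map_neg, h₁ e he]⟩

theorem mem_closure_mul_left [LocalUnits A] (x : A) :
    x ∈ AddSubgroup.closure {y : A | ∃ a z, y = AddMonoidHom.mul a z} := by
  obtain ⟨e, he, -⟩ := exists_unit₁ x
  exact AddSubgroup.subset_closure ⟨e, x, he.symm⟩

theorem mem_closure_mul_right [LocalUnits A] (x : A) :
    x ∈ AddSubgroup.closure {y : A | ∃ a z, y = AddMonoidHom.mul.flip a z} := by
  obtain ⟨e, -, he⟩ := exists_unit₁ x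
  exact AddSubgroup.subset_closure ⟨e, x, he.symm⟩

/-- The ring `A` as an `A`-bimodule. -/
abbrev regular (A : Type u) [NonUnitalRing A] [LocalUnits A] : Bimod A A where
  carrier := A
  l := AddMonoidHom.mul
  r := AddMonoidHom.mul.flip
  l_mul a a' x := mul_assoc a a' x
  r_mul b b' x := (mul_assoc x b b').symm
  l_r a b x := (mul_assoc a x b).symm
  unital_l := mem_closure_mul_left
  unital_r := mem_closure_mul_right

/-- The action map `A ⊗_A M → M`. -/
def actL [LocalUnits A] (M : Bimod A B) : tensor (regular A) M →+ M :=
  tlift (regular A) M M.l (fun a b m => M.l_mul a b m)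

/-- The action map `M ⊗_B B → M`. -/
def actR [LocalUnits B] (M : Bimod A B) : tensor M (regular B) →+ M :=
  tlift M (regular B) M.r.flip (fun m b c => (M.r_mul b c m).symm)

theorem actL_bijective [LocalUnits A] (M : Bimod A B) : Function.Bijective (actL M) := by
  have key : ∀ z : Tens (regular A) M, ∃ h₀ : A, ∀ h : A, h * h₀ = h₀ →
      z = tmul (regular A) M h (actL M z) := by
    intro z
    induction z using tens_induction with
    | h0 => exact ⟨0, fun h _ => by simp only [map_zero]⟩
    | ht a m =>
      refine ⟨a, fun h hh => ?_⟩
      change tmul (regular A) M a m = tmul (regular A) M h (M.l a m)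
      rw [← tmul_bal]
      exact congrArg (fun t => tmul (regular A) M t m) hh.symm
    | ha x y hx hy =>
      obtain ⟨e₁, h₁⟩ := hx
      obtain ⟨e₂, h₂⟩ := hy
      obtain ⟨f, ⟨hf₁, -⟩, ⟨hf₂, -⟩⟩ := exists_unit₂ e₁ e₂
      refine ⟨f, fun e he => ?_⟩
      have h3 := h₁ e (by rw [← hf₁, ← mul_assoc, he])
      have h4 := h₂ e (by rw [← hf₂, ← mul_assoc, he])
      rw [map_add, map_add, ← h3, ← h4]
  refine ⟨(injective_iff_map_eq_zero _).2 fun z hz => ?_, fun m => ?_⟩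
  · obtain ⟨h₀, h⟩ := key z
    obtain ⟨e, he, -⟩ := exists_unit₁ h₀
    rw [h e he, hz, map_zero]
  · obtain ⟨e, he⟩ := exists_l_unit M m
    exact ⟨tmul (regular A) M e m, he⟩

theorem actR_bijective [LocalUnits B] (M : Bimod A B) : Function.Bijective (actR M) := by
  have key : ∀ z : Tens M (regular B), ∃ h₀ : B, ∀ h : B, h₀ * h = h₀ →
      z = tmul M (regular B) (actR M z) h := by
    intro z
    induction z using tens_induction with
    | h0 => exact ⟨0, fun h _ => by simp only [map_zero, AddMonoidHom.zero_apply]⟩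
    | ht m a =>
      refine ⟨a, fun h hh => ?_⟩
      change tmul M (regular B) m a = tmul M (regular B) (M.r a m) h
      rw [tmul_bal]
      exact congrArg (fun t => tmul M (regular B) m t) hh.symm
    | ha x y hx hy =>
      obtain ⟨e₁, h₁⟩ := hx
      obtain ⟨e₂, h₂⟩ := hy
      obtain ⟨f, ⟨-, hf₁⟩, ⟨-, hf₂⟩⟩ := exists_unit₂ e₁ e₂
      refine ⟨f, fun e he => ?_⟩
      have h3 := h₁ e (by rw [← hf₁, mul_assoc, he])
      have h4 := h₂ e (by rw [← hf₂, mul_assoc, he])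
      rw [map_add, map_add, AddMonoidHom.add_apply, ← h3, ← h4]
  refine ⟨(injective_iff_map_eq_zero _).2 fun z hz => ?_, fun m => ?_⟩
  · obtain ⟨h₀, h⟩ := key z
    obtain ⟨e, -, he⟩ := exists_unit₁ h₀
    rw [h e he, hz, map_zero]; rfl
  · obtain ⟨e, he⟩ := exists_r_unit M m
    exact ⟨tmul M (regular B) m e, he⟩

theorem actL_isBilinear [LocalUnits A] (M : Bimod A B) : IsBilinear (actL M) :=
  isBilinear_of_tmul (M := regular A) (N := M) _ (fun a m n => M.l_mul a m n)
    (fun c m n => M.l_r m c n)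

theorem actR_isBilinear [LocalUnits B] (M : Bimod A B) : IsBilinear (actR M) :=
  isBilinear_of_tmul (M := M) (N := regular B) _ (fun a m n => (M.l_r a n m).symm)
    (fun c m n => M.r_mul n c m)

end

/-! ### The Picard group -/

instance bimodSetoid (A : Type u) [NonUnitalRing A] : Setoid (Bimod A A) where
  r := Iso
  iseqv := ⟨Iso.refl, Iso.symm, Iso.trans⟩

/-- Isomorphism classes of unital `A`-bimodules. -/
def IsoClass (A : Type u) [NonUnitalRing A] : Type (u + 1) := Quotient (bimodSetoid A)

/-- The class `[M]` of a unital bimodule. -/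
def IsoClass.mk {A : Type u} [NonUnitalRing A] (M : Bimod A A) : IsoClass A := Quotient.mk _ M

/-- The monoid of isomorphism classes of unital bimodules, with `[M] [N] = [M ⊗_A N]`
and neutral element `[A]`. -/
instance (A : Type u) [NonUnitalRing A] [LocalUnits A] : Monoid (IsoClass A) where
  mul := Quotient.map₂ tensor (fun _ _ h _ _ h' => Iso.tensor h h')
  one := IsoClass.mk (regular A)
  mul_assoc := by
    rintro ⟨M⟩ ⟨N⟩ ⟨K⟩
    exact Quotient.sound ⟨assocHom M N K, assocHom_isBilinear M N K, assocHom_bijective M N K⟩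
  one_mul := by
    rintro ⟨M⟩
    exact Quotient.sound ⟨actL M, actL_isBilinear M, actL_bijective M⟩
  mul_one := by
    rintro ⟨M⟩
    exact Quotient.sound ⟨actR M, actR_isBilinear M, actR_bijective M⟩

/-- The Picard group of a ring with local units: the classes `[P]` for which there is a unital
bimodule `Q` with `P ⊗ Q ≅ A ≅ Q ⊗ P`. -/
abbrev Pic (A : Type u) [NonUnitalRing A] [LocalUnits A] : Type (u + 1) := (IsoClass A)ˣ

section extension
variable {S : Type u} [NonUnitalRing S] [LocalUnits S]

/-! ### Restriction of scalars along `R ⊆ S` -/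

/-- The inclusion of `R` in `S` as an additive map. -/
def incl (R : NonUnitalSubring S) : R →+ S := (NonUnitalSubringClass.subtype R : R →+ S)

theorem exists_unit_mem (R : NonUnitalSubring S) [SameLocalUnits R] (a : S) :
    ∃ e : R, (e : S) * a = a ∧ a * (e : S) = a := by
  obtain ⟨e, he, h⟩ := LocalUnits.exists_unit ({a} : Finset S)
  exact ⟨⟨e, SameLocalUnits.mem e he⟩, h a (by simp)⟩

variable {B : Type u} [NonUnitalRing B]

/-- An `S`-`B`-bimodule as an `R`-`B`-bimodule. -/
abbrev resL (R : NonUnitalSubring S) [SameLocalUnits R] (M : Bimod S B) : Bimod R B where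
  carrier := M
  l := M.l.comp (incl R)
  r := M.r
  l_mul a a' x := M.l_mul a a' x
  r_mul := M.r_mul
  l_r a b x := M.l_r a b x
  unital_l x := by
    obtain ⟨s, hs⟩ := exists_l_unit M x
    obtain ⟨e, he, -⟩ := exists_unit_mem R s
    refine AddSubgroup.subset_closure ⟨e, x, ?_⟩
    calc x = M.l ((e : S) * s) x := by rw [he, hs]
      _ = M.l (e : S) x := by rw [M.l_mul, hs]
  unital_r := M.unital_r

/-- A `B`-`S`-bimodule as a `B`-`R`-bimodule. -/
abbrev resR (R : NonUnitalSubring S) [SameLocalUnits R] (M : Bimod B S) : Bimod B R where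
  carrier := M
  l := M.l
  r := M.r.comp (incl R)
  l_mul := M.l_mul
  r_mul a a' x := M.r_mul a a' x
  l_r a b x := M.l_r a b x
  unital_l := M.unital_l
  unital_r x := by
    obtain ⟨s, hs⟩ := exists_r_unit M x
    obtain ⟨e, -, he⟩ := exists_unit_mem R s
    refine AddSubgroup.subset_closure ⟨e, x, ?_⟩
    calc x = M.r (s * (e : S)) x := by rw [he, hs]
      _ = M.r (e : S) x := by rw [M.r_mul, hs]

/-! ### The monoid of isomorphism classes of objects `P ⇒ X` and the group `𝒫(S/R)` -/

variable (R : NonUnitalSubring S) [SameLocalUnits R]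

/-- The map `P ⊗_R S → X`, `p ⊗ s ↦ φ(p) s`. -/
def barR {P : Bimod R R} {X : Bimod S S} (φ : P →+ X)
    (hφ : ∀ (a : R) p, φ (P.r a p) = X.r (a : S) (φ p)) :
    tensor P (resL R (regular S)) →+ X :=
  tlift P (resL R (regular S)) (X.r.flip.comp φ) (fun p a s =>
    (congrArg (X.r s) (hφ a p)).trans (X.r_mul (a : S) s (φ p)).symm)

/-- The map `S ⊗_R P → X`, `s ⊗ p ↦ s φ(p)`. -/
def barL {P : Bimod R R} {X : Bimod S S} (φ : P →+ X)
    (hφ : ∀ (a : R) p, φ (P.l a p) = X.l (a : S) (φ p)) :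
    tensor (resR R (regular S)) P →+ X :=
  tlift (resR R (regular S)) P ((AddMonoidHom.compHom' φ).comp X.l) (fun s a p =>
    (X.l_mul s (a : S) (φ p)).trans (congrArg (X.l s) (hφ a p)).symm)

/-- The objects `φ : P ⇒ X` of the category `ℳ(S/R)`: a unital `R`-bimodule `P`, a unital
`S`-bimodule `X`, and an `R`-bilinear map `φ : P → X` such that `P ⊗_R S → X` and
`S ⊗_R P → X` are bijective. -/
structure Obj : Type (u + 1) where
  P : Bimod R R
  X : Bimod S S
  φ : P →+ X
  φ_l : ∀ (a : R) p, φ (P.l a p) = X.l (a : S) (φ p)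
  φ_r : ∀ (a : R) p, φ (P.r a p) = X.r (a : S) (φ p)
  bij_r : Function.Bijective (barR R φ φ_r)
  bij_l : Function.Bijective (barL R φ φ_l)

variable {R}

/-- Isomorphism in `ℳ(S/R)`. -/
def Obj.Iso (U V : Obj R) : Prop :=
  ∃ (α : U.P →+ V.P) (β : U.X →+ V.X), IsBilinear α ∧ IsBilinear β ∧
    Function.Bijective α ∧ Function.Bijective β ∧ ∀ p, β (U.φ p) = V.φ (α p)

/-- The map `χ : P ⊗_R Q → X ⊗_S Y`, `p ⊗ q ↦ φ(p) ⊗ ψ(q)`. -/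
def chi (U V : Obj R) : tensor U.P V.P →+ tensor U.X V.X :=
  tlift U.P V.P (((AddMonoidHom.compHom' V.φ).comp (tmul U.X V.X)).comp U.φ) (fun p a q => by
    change tmul U.X V.X (U.φ (U.P.r a p)) (V.φ q) = tmul U.X V.X (U.φ p) (V.φ (V.P.l a q))
    rw [U.φ_r, V.φ_l, tmul_bal])

@[simp] theorem chi_tmul (U V : Obj R) (p q) :
    chi U V (tmul U.P V.P p q) = tmul U.X V.X (U.φ p) (V.φ q) := rfl

theorem chi_l (U V : Obj R) (a : R) (z) :
    chi U V ((tensor U.P V.P).l a z) = (tensor U.X V.X).l (a : S) (chi U V z) :=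
  DFunLike.congr_fun (f := (chi U V).comp ((tensor U.P V.P).l a))
    (g := ((tensor U.X V.X).l (a : S)).comp (chi U V))
    (tens_hom_ext fun p q =>
      congrArg (fun t => tmul U.X V.X t (V.φ q)) (U.φ_l a p)) z

theorem chi_r (U V : Obj R) (a : R) (z) :
    chi U V ((tensor U.P V.P).r a z) = (tensor U.X V.X).r (a : S) (chi U V z) :=
  DFunLike.congr_fun (f := (chi U V).comp ((tensor U.P V.P).r a))
    (g := ((tensor U.X V.X).r (a : S)).comp (chi U V))
    (tens_hom_ext fun p q =>
      congrArg (fun t => tmul U.X V.X (U.φ p) t) (V.φ_r a q)) z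

/-- The comparison `P ⊗_R Y → X ⊗_S Y`, `p ⊗ y ↦ φ(p) ⊗ y`. -/
def cmpR (U : Obj R) (Y : Bimod S B) : tensor U.P (resL R Y) →+ tensor U.X Y :=
  tlift U.P (resL R Y) ((tmul U.X Y).comp U.φ) (fun p a y =>
    (congrArg (fun t => tmul U.X Y t y) (U.φ_r a p)).trans
      (tmul_bal U.X Y (U.φ p) (a : S) y))

/-- The comparison `Y ⊗_R P → Y ⊗_S X`, `y ⊗ p ↦ y ⊗ φ(p)`. -/
def cmpL (U : Obj R) (Y : Bimod B S) : tensor (resR R Y) U.P →+ tensor Y U.X :=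
  tlift (resR R Y) U.P ((AddMonoidHom.compHom' U.φ).comp (tmul Y U.X)) (fun y a p =>
    (tmul_bal Y U.X y (a : S) (U.φ p)).trans
      (congrArg (tmul Y U.X y) (U.φ_l a p)).symm)

theorem cmpR_bijective (U : Obj R) (Y : Bimod S B) : Function.Bijective (cmpR U Y) := by
  -- compare with the chain P ⊗ Y ← P ⊗ (S ⊗ Y) ← (P ⊗ S) ⊗ Y → X ⊗ Y
  let f₁ : tensor U.P (tensor (resL R (regular S)) Y) →+ tensor U.P (resL R Y) :=
    tmap U.P (tensor (resL R (regular S)) Y) U.P (resL R Y) (AddMonoidHom.id _) (actL Y)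
      (fun _ _ => rfl) (fun a z => (actL_isBilinear Y).map_l (a : S) z)
  have h₁ : Function.Bijective f₁ :=
    tmap_bijective _ _ _ _ _ _ _ _ Function.bijective_id (actL_bijective Y)
  let f₂ := assocHom U.P (resL R (regular S)) Y
  have h₂ : Function.Bijective f₂ := assocHom_bijective _ _ _
  let f₃ : tensor (tensor U.P (resL R (regular S))) Y →+ tensor U.X Y :=
    tmap (tensor U.P (resL R (regular S))) Y U.X Y (barR R U.φ U.φ_r) (AddMonoidHom.id _)
      (fun s z => DFunLike.congr_fun
        (f := (barR R U.φ U.φ_r).comp ((tensor U.P (resL R (regular S))).r s))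
        (g := (U.X.r s).comp (barR R U.φ U.φ_r))
        (tens_hom_ext fun p t => U.X.r_mul t s (U.φ p)) z)
      (fun _ _ => rfl)
  have h₃ : Function.Bijective f₃ :=
    tmap_bijective _ _ _ _ _ _ _ _ U.bij_r Function.bijective_id
  have h : (cmpR U Y).comp (f₁.comp f₂) = f₃ := tens₃_hom_ext fun p s y =>
    (tmul_bal U.X Y (U.φ p) s y).symm
  have h' : ⇑(cmpR U Y) ∘ (f₁ ∘ f₂) = f₃ := funext fun z => DFunLike.congr_fun h z
  exact (Function.Bijective.of_comp_iff _ (h₁.comp h₂)).1 (h' ▸ h₃)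

theorem cmpL_bijective (U : Obj R) (Y : Bimod B S) : Function.Bijective (cmpL U Y) := by
  let f₁ : tensor (tensor Y (resR R (regular S))) U.P →+ tensor (resR R Y) U.P :=
    tmap (tensor Y (resR R (regular S))) U.P (resR R Y) U.P (actR Y) (AddMonoidHom.id _)
      (fun a z => (actR_isBilinear Y).map_r (a : S) z) (fun _ _ => rfl)
  have h₁ : Function.Bijective f₁ :=
    tmap_bijective _ _ _ _ _ _ _ _ (actR_bijective Y) Function.bijective_id
  let f₂ := assocInv Y (resR R (regular S)) U.P
  have h₂ : Function.Bijective f₂ := Function.bijective_iff_has_inverse.2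
    ⟨assocHom Y (resR R (regular S)) U.P,
      fun z => DFunLike.congr_fun (f := (assocHom Y (resR R (regular S)) U.P).comp f₂)
        (g := AddMonoidHom.id _) (tens₃_hom_ext' fun _ _ _ => rfl) z,
      fun z => DFunLike.congr_fun (f := f₂.comp (assocHom Y (resR R (regular S)) U.P))
        (g := AddMonoidHom.id _) (tens₃_hom_ext fun _ _ _ => rfl) z⟩
  let f₃ : tensor Y (tensor (resR R (regular S)) U.P) →+ tensor Y U.X :=
    tmap Y (tensor (resR R (regular S)) U.P) Y U.X (AddMonoidHom.id _) (barL R U.φ U.φ_l)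
      (fun _ _ => rfl)
      (fun s z => DFunLike.congr_fun
        (f := (barL R U.φ U.φ_l).comp ((tensor (resR R (regular S)) U.P).l s))
        (g := (U.X.l s).comp (barL R U.φ U.φ_l))
        (tens_hom_ext fun t p => U.X.l_mul s t (U.φ p)) z)
  have h₃ : Function.Bijective f₃ :=
    tmap_bijective _ _ _ _ _ _ _ _ Function.bijective_id U.bij_l
  have h : (cmpL U Y).comp (f₁.comp f₂) = f₃ := tens₃_hom_ext' fun y s p =>
    tmul_bal Y U.X y s (U.φ p)
  have h' : ⇑(cmpL U Y) ∘ (f₁ ∘ f₂) = f₃ := funext fun z => DFunLike.congr_fun h z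
  exact (Function.Bijective.of_comp_iff _ (h₁.comp h₂)).1 (h' ▸ h₃)

/-- The product object `P ⊗_R Q ⇒ X ⊗_S Y`. -/
def Obj.mul (U V : Obj R) : Obj R where
  P := tensor U.P V.P
  X := tensor U.X V.X
  φ := chi U V
  φ_l := chi_l U V
  φ_r := chi_r U V
  bij_r := by
    let f₁ := assocHom U.P V.P (resL R (regular S))
    let f₂ : tensor U.P (tensor V.P (resL R (regular S))) →+ tensor U.P (resL R V.X) :=
      tmap U.P (tensor V.P (resL R (regular S))) U.P (resL R V.X) (AddMonoidHom.id _)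
        (barR R V.φ V.φ_r) (fun _ _ => rfl)
        (fun a z => DFunLike.congr_fun
          (f := (barR R V.φ V.φ_r).comp ((tensor V.P (resL R (regular S))).l a))
          (g := (V.X.l (a : S)).comp (barR R V.φ V.φ_r))
          (tens_hom_ext fun p s => by
            change V.X.r s (V.φ (V.P.l a p)) = V.X.l (a : S) (V.X.r s (V.φ p))
            rw [V.φ_l, V.X.l_r]) z)
    have h₂ : Function.Bijective f₂ :=
      tmap_bijective _ _ _ _ _ _ _ _ Function.bijective_id V.bij_r
    have h : barR R (chi U V) (chi_r U V) = (cmpR U V.X).comp (f₂.comp f₁) :=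
      tens₃_hom_ext fun p q s => rfl
    rw [h]
    exact (cmpR_bijective U V.X).comp (h₂.comp (assocHom_bijective _ _ _))
  bij_l := by
    let f₁ := assocHom (resR R (regular S)) U.P V.P
    let f₂ : tensor (tensor (resR R (regular S)) U.P) V.P →+ tensor (resR R U.X) V.P :=
      tmap (tensor (resR R (regular S)) U.P) V.P (resR R U.X) V.P
        (barL R U.φ U.φ_l) (AddMonoidHom.id _)
        (fun a z => DFunLike.congr_fun
          (f := (barL R U.φ U.φ_l).comp ((tensor (resR R (regular S)) U.P).r a))
          (g := (U.X.r (a : S)).comp (barL R U.φ U.φ_l))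
          (tens_hom_ext fun s p => by
            change U.X.l s (U.φ (U.P.r a p)) = U.X.r (a : S) (U.X.l s (U.φ p))
            rw [U.φ_r, U.X.l_r]) z)
        (fun _ _ => rfl)
    have h₂ : Function.Bijective f₂ :=
      tmap_bijective _ _ _ _ _ _ _ _ U.bij_l Function.bijective_id
    have h : (barL R (chi U V) (chi_l U V)).comp f₁ = (cmpL V U.X).comp f₂ :=
      tens₃_hom_ext fun s p q => rfl
    have h' : ⇑(barL R (chi U V) (chi_l U V)) ∘ f₁ = cmpL V U.X ∘ f₂ :=
      funext fun z => DFunLike.congr_fun h z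
    refine (Function.Bijective.of_comp_iff _ (assocHom_bijective _ _ _)).1 ?_
    change Function.Bijective (⇑(barL R (chi U V) (chi_l U V)) ∘ f₁)
    rw [h']
    exact (cmpL_bijective V U.X).comp h₂

variable (R)

/-- For a ring endomorphism `γ` of `S` that acts as the identity on `R`: the unital `S`-bimodule
`S_γ`, that is, the group `S` with `t · x = t x` and `x · t = x γ(t)`. -/
abbrev twist (γ : S →ₙ+* S) (hγ : ∀ x ∈ R, γ x = x) : Bimod S S where
  carrier := S
  l := AddMonoidHom.mul
  r := AddMonoidHom.mul.flip.comp (γ : S →+ S)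
  l_mul a a' x := mul_assoc a a' x
  r_mul b b' x := (congrArg (x * ·) (map_mul γ b b')).trans (mul_assoc x (γ b) (γ b')).symm
  l_r a b x := (mul_assoc a x (γ b)).symm
  unital_l := mem_closure_mul_left
  unital_r x := by
    obtain ⟨e, -, he⟩ := exists_unit_mem R x
    exact AddSubgroup.subset_closure ⟨e, x,
      ((congrArg (x * ·) (hγ e e.2)).trans he).symm⟩

/-- The object `ι_γ : R ⇒ S_γ`, where `ι_γ` is the inclusion `R ⊆ S` and `γ` is a bijective
ring endomorphism of `S` that acts as the identity on `R`. -/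
def twistObj (γ : S →ₙ+* S) (hγ : ∀ x ∈ R, γ x = x) (hb : Function.Bijective γ) : Obj R where
  P := regular R
  X := twist R γ hγ
  φ := incl R
  φ_l _ _ := rfl
  φ_r a p := congrArg ((p : S) * ·) (hγ a a.2).symm
  bij_r := by
    have h : barR R (P := regular R) (X := twist R γ hγ) (incl R)
        (fun a p => congrArg ((p : S) * ·) (hγ a a.2).symm)
        = (γ : S →+ S).comp (actL (resL R (regular S))) :=
      tens_hom_ext fun p s =>
        ((map_mul γ (p : S) s).trans (congrArg (· * γ s) (hγ p p.2))).symm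
    rw [h]
    exact hb.comp (actL_bijective _)
  bij_l := actR_bijective (resR R (regular S))

/-- The object `ι : R ⇒ S` given by the inclusion. -/
def Obj.one : Obj R where
  P := regular R
  X := regular S
  φ := incl R
  φ_l _ _ := rfl
  φ_r _ _ := rfl
  bij_r := actL_bijective (resL R (regular S))
  bij_l := actR_bijective (resR R (regular S))

instance objSetoid : Setoid (Obj R) where
  r := Obj.Iso
  iseqv := by
    refine ⟨fun U => ⟨.id _, .id _, .id _, .id _, Function.bijective_id, Function.bijective_id,
      fun _ => rfl⟩, ?_, ?_⟩
    · rintro U V ⟨α, β, hα, hβ, hαb, hβb, h⟩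
      obtain ⟨α', hα', hαb', h₁, h₂⟩ := hα.exists_inv hαb
      obtain ⟨β', hβ', hβb', h₃, h₄⟩ := hβ.exists_inv hβb
      exact ⟨α', β', hα', hβ', hαb', hβb', fun p => hβb.1 (by rw [h₄, h, h₂])⟩
    · rintro U V W ⟨α, β, hα, hβ, hαb, hβb, h⟩ ⟨α', β', hα', hβ', hαb', hβb', h'⟩
      exact ⟨α'.comp α, β'.comp β, hα'.comp hα, hβ'.comp hβ, hαb'.comp hαb, hβb'.comp hβb,
        fun p => by simp [h, h']⟩

/-- The set `𝒮(S/R)` of isomorphism classes of objects of `ℳ(S/R)`. -/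
def Skel : Type (u + 1) := Quotient (objSetoid R)

variable {R}

/-- The isomorphism class of an object of `ℳ(S/R)`. -/
def Skel.mk (U : Obj R) : Skel R := Quotient.mk _ U

/-- The monoid structure of `𝒮(S/R)`: the product of the classes of `P ⇒ X` and `Q ⇒ Y` is the
class of `P ⊗_R Q ⇒ X ⊗_S Y`, and the neutral element is the class of `R ⇒ S`. -/
instance : Monoid (Skel R) where
  mul := Quotient.map₂ Obj.mul (by
    rintro U V ⟨α, β, hα, hβ, hαb, hβb, h⟩ U' V' ⟨α', β', hα', hβ', hαb', hβb', h'⟩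
    refine ⟨tmap U.P U'.P V.P V'.P α α' hα.map_r hα'.map_l,
      tmap U.X U'.X V.X V'.X β β' hβ.map_r hβ'.map_l, tmap_isBilinear hα hα',
      tmap_isBilinear hβ hβ', tmap_bijective _ _ _ _ _ _ _ _ hαb hαb',
      tmap_bijective _ _ _ _ _ _ _ _ hβb hβb', fun z => ?_⟩
    exact DFunLike.congr_fun
      (f := (tmap U.X U'.X V.X V'.X β β' hβ.map_r hβ'.map_l).comp (chi U U'))
      (g := (chi V V').comp (tmap U.P U'.P V.P V'.P α α' hα.map_r hα'.map_l))
      (tens_hom_ext fun p q => by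
        change tmul V.X V'.X (β (U.φ p)) (β' (U'.φ q))
          = tmul V.X V'.X (V.φ (α p)) (V'.φ (α' q))
        rw [h, h']) z)
  one := Skel.mk (Obj.one R)
  mul_assoc := by
    rintro ⟨U⟩ ⟨V⟩ ⟨W⟩
    refine Quotient.sound ⟨assocHom U.P V.P W.P, assocHom U.X V.X W.X,
      assocHom_isBilinear _ _ _, assocHom_isBilinear _ _ _,
      assocHom_bijective _ _ _, assocHom_bijective _ _ _, fun z => ?_⟩
    exact DFunLike.congr_fun
      (f := (assocHom U.X V.X W.X).comp (chi (Obj.mul U V) W))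
      (g := (chi U (Obj.mul V W)).comp (assocHom U.P V.P W.P))
      (tens₃_hom_ext fun _ _ _ => rfl) z
  one_mul := by
    rintro ⟨U⟩
    refine Quotient.sound ⟨actL U.P, actL U.X, actL_isBilinear _, actL_isBilinear _,
      actL_bijective _, actL_bijective _, fun z => ?_⟩
    exact DFunLike.congr_fun (f := (actL U.X).comp (chi (Obj.one R) U))
      (g := U.φ.comp (actL U.P)) (tens_hom_ext fun a p => (U.φ_l a p).symm) z
  mul_one := by
    rintro ⟨U⟩
    refine Quotient.sound ⟨actR U.P, actR U.X, actR_isBilinear _, actR_isBilinear _,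
      actR_bijective _, actR_bijective _, fun z => ?_⟩
    exact DFunLike.congr_fun (f := (actR U.X).comp (chi U (Obj.one R)))
      (g := U.φ.comp (actR U.P)) (tens_hom_ext fun p a => (U.φ_r a p).symm) z

variable (R)

/-- The homomorphism `[P ⇒ X] ↦ [P]`. -/
def classP : Skel R →* IsoClass R where
  toFun := Quotient.map (fun U : Obj R => U.P) (fun _ _ ⟨α, _, hα, _, hb, _⟩ => ⟨α, hα, hb⟩)
  map_one' := rfl
  map_mul' := by rintro ⟨U⟩ ⟨V⟩; rfl

/-- The homomorphism `[P ⇒ X] ↦ [X]`. -/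
def classX : Skel R →* IsoClass S where
  toFun := Quotient.map (fun U : Obj R => U.X) (fun _ _ ⟨_, β, _, hβ, _, hb, _⟩ => ⟨β, hβ, hb⟩)
  map_one' := rfl
  map_mul' := by rintro ⟨U⟩ ⟨V⟩; rfl

/-- `𝒫(S/R)`: the submonoid of `𝒮(S/R)` of the classes of those `P ⇒ X` with `[P] ∈ Pic R` and
`[X] ∈ Pic S`. -/
def PSR : Submonoid (Skel R) :=
  (IsUnit.submonoid (IsoClass R)).comap (classP R) ⊓
    (IsUnit.submonoid (IsoClass S)).comap (classX R)

end extension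

/-! ### The groups `Aut_{S-R}(S)`, `Aut_{R-rings}(S)` and `Inv_R(S)` -/

section groups
variable {S : Type u} [NonUnitalRing S] (R : NonUnitalSubring S)

/-- The monoid of `S`-`R`-bilinear endomorphisms of `S` under composition. -/
def endSR : Submonoid (AddMonoid.End S) where
  carrier := {f | (∀ s x, f (s * x) = s * f x) ∧ ∀ x, ∀ r ∈ R, f (x * r) = f x * r}
  one_mem' := ⟨fun _ _ => rfl, fun _ _ _ => rfl⟩
  mul_mem' {f g} hf hg := by
    refine ⟨fun s x => ?_, fun x r hr => ?_⟩
    · rw [show ∀ z, (f * g) z = f (g z) from fun _ => rfl, hg.1, hf.1]; rfl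
    · rw [show ∀ z, (f * g) z = f (g z) from fun _ => rfl, hg.2 x r hr, hf.2 _ r hr]; rfl

/-- `Aut_{S-R}(S)`, the units group of the monoid of `S`-`R`-bilinear endomorphisms. -/
abbrev AutSR : Type u := (endSR R)ˣ

/-- The monoid of ring endomorphisms of `S` acting as the identity on `R`, under composition. -/
def endRings : Submonoid (S →ₙ+* S) where
  carrier := {f | ∀ r ∈ R, f r = r}
  one_mem' := fun _ _ => rfl
  mul_mem' {f g} hf hg := fun r hr => by
    change f (g r) = r
    rw [hg r hr, hf r hr]

/-- `Aut_{R-rings}(S)`, the units group of the monoid of ring endomorphisms of `S` acting as the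
identity on `R`. -/
abbrev AutRings : Type u := (endRings R)ˣ

variable {R}

/-- The map `S → S` underlying an element of `Aut_{S-R}(S)`. -/
def AutSR.toFun (lam : AutSR R) : S → S := ((lam : endSR R) : AddMonoid.End S)

/-- The ring homomorphism `S → S` underlying an element of `Aut_{R-rings}(S)`. -/
def AutRings.hom (γ : AutRings R) : S →ₙ+* S := ((γ : endRings R) : S →ₙ+* S)

theorem AutRings.hom_of_mem (γ : AutRings R) : ∀ r ∈ R, γ.hom r = r := (γ : endRings R).2

theorem AutRings.bijective (γ : AutRings R) : Function.Bijective γ.hom := by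
  have h₁ : γ⁻¹.hom * γ.hom = 1 := congrArg Subtype.val (Units.inv_mul γ)
  have h₂ : γ.hom * γ⁻¹.hom = 1 := congrArg Subtype.val (Units.mul_inv γ)
  exact Function.bijective_iff_has_inverse.2
    ⟨γ⁻¹.hom, fun x => DFunLike.congr_fun h₁ x, fun x => DFunLike.congr_fun h₂ x⟩

variable (R)

/-- The `R`-subbimodules of `S`. They are automatically unital (see `SubBimod.unital`) when
`R ⊆ S` have the same set of local units. -/
@[ext]
structure SubBimod extends AddSubgroup S where
  l_mem : ∀ r ∈ R, ∀ x ∈ carrier, r * x ∈ carrier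
  r_mem : ∀ r ∈ R, ∀ x ∈ carrier, x * r ∈ carrier

variable {R}

theorem SubBimod.unital [LocalUnits S] [SameLocalUnits R] (X : SubBimod R) (x : S)
    (hx : x ∈ X.toAddSubgroup) :
    x ∈ AddSubgroup.closure {z | ∃ r ∈ R, ∃ y ∈ X.toAddSubgroup, z = r * y} ∧
    x ∈ AddSubgroup.closure {z | ∃ r ∈ R, ∃ y ∈ X.toAddSubgroup, z = y * r} := by
  obtain ⟨e, h₁, h₂⟩ := exists_unit_mem R x
  exact ⟨AddSubgroup.subset_closure ⟨e, e.2, x, hx, h₁.symm⟩,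
    AddSubgroup.subset_closure ⟨e, e.2, x, hx, h₂.symm⟩⟩

/-- The product `W V`: the finite sums of products `w v`. -/
def SubBimod.mul (W V : SubBimod R) : SubBimod R where
  toAddSubgroup := AddSubgroup.closure
    {z | ∃ w ∈ W.toAddSubgroup, ∃ v ∈ V.toAddSubgroup, z = w * v}
  l_mem r hr x hx := by
    change x ∈ AddSubgroup.closure _ at hx
    change r * x ∈ AddSubgroup.closure _
    induction hx using AddSubgroup.closure_induction with
    | mem x h =>
      obtain ⟨w, hw, v, hv, rfl⟩ := h
      exact AddSubgroup.subset_closure ⟨r * w, W.l_mem r hr w hw, v, hv, (mul_assoc _ _ _).symm⟩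
    | zero => rw [mul_zero]; exact zero_mem _
    | add x y _ _ hx hy => rw [mul_add]; exact add_mem hx hy
    | neg x _ hx => rw [mul_neg]; exact neg_mem hx
  r_mem r hr x hx := by
    change x ∈ AddSubgroup.closure _ at hx
    change x * r ∈ AddSubgroup.closure _
    induction hx using AddSubgroup.closure_induction with
    | mem x h =>
      obtain ⟨w, hw, v, hv, rfl⟩ := h
      exact AddSubgroup.subset_closure ⟨w, hw, v * r, V.r_mem r hr v hv, mul_assoc _ _ _⟩
    | zero => rw [zero_mul]; exact zero_mem _
    | add x y _ _ hx hy => rw [add_mul]; exact add_mem hx hy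
    | neg x _ hx => rw [neg_mul]; exact neg_mem hx

theorem SubBimod.mul_mem_mul {W V : SubBimod R} {w v : S} (hw : w ∈ W.toAddSubgroup)
    (hv : v ∈ V.toAddSubgroup) : w * v ∈ (W.mul V).toAddSubgroup :=
  AddSubgroup.subset_closure ⟨w, hw, v, hv, rfl⟩

theorem SubBimod.mul_le {W V : SubBimod R} {G : AddSubgroup S}
    (h : ∀ w ∈ W.toAddSubgroup, ∀ v ∈ V.toAddSubgroup, w * v ∈ G) :
    (W.mul V).toAddSubgroup ≤ G :=
  (AddSubgroup.closure_le G).2 (by rintro _ ⟨w, hw, v, hv, rfl⟩; exact h w hw v hv)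

theorem SubBimod.eq_of_le {W V : SubBimod R} (h₁ : W.toAddSubgroup ≤ V.toAddSubgroup)
    (h₂ : V.toAddSubgroup ≤ W.toAddSubgroup) : W = V :=
  SubBimod.ext (Set.Subset.antisymm h₁ h₂)

variable (R)

/-- `R` as an `R`-subbimodule of `S`. -/
def SubBimod.one : SubBimod R where
  toAddSubgroup := R.toAddSubgroup
  l_mem _ hr _ hx := mul_mem (S := NonUnitalSubring S) (s := R) hr hx
  r_mem _ hr _ hx := mul_mem (S := NonUnitalSubring S) (s := R) hx hr

variable {R}

/-- The monoid of `R`-subbimodules of `S`, with neutral element `R`. -/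
instance [LocalUnits S] [SameLocalUnits R] : Monoid (SubBimod R) where
  mul := SubBimod.mul
  one := SubBimod.one R
  mul_assoc X Y Z := by
    apply SubBimod.eq_of_le
    · refine SubBimod.mul_le fun w hw z hz => ?_
      refine (AddSubgroup.closure_le (((X.mul (Y.mul Z)).toAddSubgroup).comap
        (AddMonoidHom.mulRight z))).2 ?_ hw
      rintro _ ⟨x, hx, y, hy, rfl⟩
      change x * y * z ∈ (X.mul (Y.mul Z)).toAddSubgroup
      rw [mul_assoc]
      exact SubBimod.mul_mem_mul hx (SubBimod.mul_mem_mul hy hz)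
    · refine SubBimod.mul_le fun x hx w hw => ?_
      refine (AddSubgroup.closure_le ((((X.mul Y).mul Z).toAddSubgroup).comap
        (AddMonoidHom.mulLeft x))).2 ?_ hw
      rintro _ ⟨y, hy, z, hz, rfl⟩
      change x * (y * z) ∈ ((X.mul Y).mul Z).toAddSubgroup
      rw [← mul_assoc]
      exact SubBimod.mul_mem_mul (SubBimod.mul_mem_mul hx hy) hz
  one_mul X := by
    apply SubBimod.eq_of_le
    · exact SubBimod.mul_le fun r hr x hx => X.l_mem r hr x hx
    · intro x hx
      obtain ⟨e, he, -⟩ := exists_unit_mem R x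
      have := SubBimod.mul_mem_mul (W := SubBimod.one R) (w := (e : S)) e.2 hx
      rwa [he] at this
  mul_one X := by
    apply SubBimod.eq_of_le
    · exact SubBimod.mul_le fun x hx r hr => X.r_mem r hr x hx
    · intro x hx
      obtain ⟨e, -, he⟩ := exists_unit_mem R x
      have := SubBimod.mul_mem_mul (V := SubBimod.one R) (v := (e : S)) hx e.2
      rwa [he] at this

variable (R)

/-- `Inv_R(S)`: the group of the `R`-subbimodules `X` of `S` for which there is an
`R`-subbimodule `Y` with `X Y = Y X = R`. -/
abbrev InvR [LocalUnits S] [SameLocalUnits R] : Type u := (SubBimod R)ˣ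

variable {R}

/-- The class of `ι_γ : R ⇒ S_γ`. -/
def twistClass [LocalUnits S] [SameLocalUnits R] (γ : AutRings R) : Skel R :=
  Skel.mk (twistObj R γ.hom γ.hom_of_mem γ.bijective)

end groups

end LURing

open LURing

/-!
For a ring with identity everything reduces to units of `S`: an `S`-`R`-bilinear automorphism `λ`
of `S` is right multiplication by a unit `u` centralizing `R`, and `λ⁻¹(R) = R u⁻¹`,
`λ̂(s) = u⁻¹ s u`. With local units, `u` is replaced by the values `λ(e)`: for a left unit `e ∈ R`
of `s` one has `λ̂(s) = λ⁻¹(e) λ(s)`, independently of `e` (`AutSR.hatFun_eq`), and all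
computations are made over one `e` that is a unit for every element involved.

Exactness at `Aut_{R-rings}(S)` (`twistClass_eq_one_iff`): an isomorphism from `R ⇒ S_γ` to `R ⇒ S`
is an `S`-`R`-bilinear bijection `β` of `S` with `β(R) = R` and `β(x γ(t)) = β(x) t`, and these are
the maps `λ⁻¹` with `λ ∈ Ker 𝒟` and `λ̂ = γ`.

Exactness at `𝒫(S/R)` (`exists_twistClass_eq`): an object `φ : P ⇒ X` with `P ≅ R` has two
bijections `s ↦ s φ(e)` and `s ↦ φ(e) s` from `S` to `X`. Comparing them yields the ring
automorphism `γ` with `φ(e) t = γ(t) φ(e)`, and the first one is an isomorphism `S_γ ≅ X`.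

Invertibility of the class of `P ⇒ X` in `𝒫(S/R)` (`isUnit_of_mem_PSR`): let `Q` and `Y` be
inverse to `P` and `X`. After adjusting the pairings (`exists_compatible_pairing`) there is an object
`Q ⇒ Y` (`exists_obj_of_inverses`). It need not be shown inverse to `P ⇒ X`: both products have
first component isomorphic to `R`, so they are of the form `[R ⇒ S_γ]` by the previous paragraph, and
these classes are units because `γ ↦ [R ⇒ S_γ]` is a homomorphism from a group.
-/

namespace LURing

/-! ### The homomorphism `𝒟` -/

section AutSR
variable {S : Type u} [NonUnitalRing S] {R : NonUnitalSubring S}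

namespace AutSR

theorem map_add (lam : AutSR R) (x y : S) : lam.toFun (x + y) = lam.toFun x + lam.toFun y :=
  _root_.map_add ((lam : endSR R) : AddMonoid.End S) x y

theorem map_left (lam : AutSR R) (s x : S) : lam.toFun (s * x) = s * lam.toFun x :=
  (lam : endSR R).2.1 s x

theorem map_right (lam : AutSR R) (x : S) {r : S} (hr : r ∈ R) :
    lam.toFun (x * r) = lam.toFun x * r :=
  (lam : endSR R).2.2 x r hr

@[simp] theorem inv_apply_self (lam : AutSR R) (x : S) : lam⁻¹.toFun (lam.toFun x) = x :=
  DFunLike.congr_fun (congrArg Subtype.val (Units.inv_mul lam)) x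

@[simp] theorem apply_inv_self (lam : AutSR R) (x : S) : lam.toFun (lam⁻¹.toFun x) = x :=
  DFunLike.congr_fun (congrArg Subtype.val (Units.mul_inv lam)) x

theorem bijective (lam : AutSR R) : Function.Bijective lam.toFun :=
  Function.bijective_iff_has_inverse.2 ⟨lam⁻¹.toFun, lam.inv_apply_self, lam.apply_inv_self⟩

theorem mul_inv_apply (lam mu : AutSR R) (x : S) :
    (lam * mu)⁻¹.toFun x = mu⁻¹.toFun (lam⁻¹.toFun x) := by
  rw [mul_inv_rev]; rfl

theorem inv_mul_eq_of_unit (lam : AutSR R) {s e f : S} (he : e ∈ R) (hes : e * s = s)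
    (hfe : f * e = e) : lam⁻¹.toFun e * lam.toFun s = lam⁻¹.toFun f * lam.toFun s := by
  rw [← hfe, map_right _ _ he, mul_assoc, ← map_left, hes]

theorem mul_inv_apply_unit (lam : AutSR R) {s e : S} (he : e ∈ R) (hse : s * e = s) :
    lam.toFun s * lam⁻¹.toFun e = s := by
  rw [← map_left, ← map_right _ _ he, hse, inv_apply_self]

/-- The automorphism with inverse a given bijective `S`-`R`-bilinear map `β`. -/
theorem exists_inv_eq (β : S →+ S) (hb : Function.Bijective β) (hl : ∀ s x, β (s * x) = s * β x)
    (hr : ∀ x, ∀ r ∈ R, β (x * r) = β x * r) : ∃ lam : AutSR R, ∀ x, lam⁻¹.toFun x = β x := by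
  let e := AddEquiv.ofBijective β hb
  have h1 : ∀ x, e.symm (β x) = x := e.symm_apply_apply
  have h2 : ∀ x, β (e.symm x) = x := e.apply_symm_apply
  let b : endSR R := ⟨β, hl, hr⟩
  let c : endSR R := ⟨e.symm.toAddMonoidHom,
    fun s x => hb.1 <| by
      change β (e.symm _) = β (s * e.symm x)
      rw [h2, hl, h2],
    fun x r hrR => hb.1 <| by
      change β (e.symm _) = β (e.symm x * r)
      rw [h2, hr _ _ hrR, h2]⟩
  exact ⟨⟨c, b, Subtype.ext (AddMonoidHom.ext h1), Subtype.ext (AddMonoidHom.ext h2)⟩,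
    fun x => rfl⟩

/-- The subbimodule `λ⁻¹(R)`. -/
def preimage (lam : AutSR R) : SubBimod R where
  toAddSubgroup := R.toAddSubgroup.map ((lam⁻¹ : AutSR R) : endSR R).1
  l_mem := by
    rintro r hr _ ⟨x, hx, rfl⟩
    exact ⟨r * x, mul_mem (S := NonUnitalSubring S) (s := R) hr hx, lam⁻¹.map_left r x⟩
  r_mem := by
    rintro r hr _ ⟨x, hx, rfl⟩
    exact ⟨x * r, mul_mem (S := NonUnitalSubring S) (s := R) hx hr, lam⁻¹.map_right x hr⟩

theorem mem_preimage {lam : AutSR R} {x : S} :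
    x ∈ lam.preimage.toAddSubgroup ↔ ∃ r ∈ R, lam⁻¹.toFun r = x := Iff.rfl

end AutSR

variable [LocalUnits S] [SameLocalUnits R]

theorem AutSR.preimage_mul (lam mu : AutSR R) :
    (lam * mu).preimage = lam.preimage * mu.preimage := by
  apply SubBimod.eq_of_le
  · intro x hx
    obtain ⟨r, hr, rfl⟩ := mem_preimage.1 hx
    obtain ⟨e, -, he⟩ := exists_unit_mem R (lam⁻¹.toFun r)
    rw [mul_inv_apply, ← he, map_left]
    exact SubBimod.mul_mem_mul (mem_preimage.2 ⟨r, hr, rfl⟩) (mem_preimage.2 ⟨e, e.2, rfl⟩)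
  · refine SubBimod.mul_le fun x hx y hy => ?_
    obtain ⟨r, hr, rfl⟩ := mem_preimage.1 hx
    obtain ⟨r', hr', rfl⟩ := mem_preimage.1 hy
    refine mem_preimage.2 ⟨r * r', mul_mem hr hr', ?_⟩
    rw [mul_inv_apply, map_right _ _ hr', map_left]

variable (R) in
/-- The homomorphism `λ ↦ λ⁻¹(R)` to the group `Inv_R(S)`. -/
def invHom : AutSR R →* InvR R :=
  MonoidHom.toHomUnits
    { toFun := AutSR.preimage
      map_one' := SubBimod.ext (Set.image_id _)
      map_mul' := AutSR.preimage_mul }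

theorem mem_ker_invHom {lam : AutSR R} :
    lam ∈ (invHom R).ker ↔ lam⁻¹.toFun '' (R : Set S) = R := by
  rw [MonoidHom.mem_ker, Units.ext_iff, SubBimod.ext_iff]
  rfl

/-! ### The homomorphism `λ ↦ λ̂` -/

variable (R) in
theorem exists_unit_mem₂ (a b : S) : ∃ e ∈ R,
    (e * a = a ∧ a * e = a) ∧ (e * b = b ∧ b * e = b) := by
  classical
  obtain ⟨e, he, h⟩ := LocalUnits.exists_unit ({a, b} : Finset S)
  exact ⟨e, SameLocalUnits.mem e he, h a (by simp), h b (by simp)⟩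

namespace AutSR

/-- The value `λ̂(s)`, computed as `λ⁻¹(e) λ(s)` for a chosen left unit `e` of `s`. -/
noncomputable def hatFun (lam : AutSR R) (s : S) : S :=
  lam⁻¹.toFun ((exists_unit_mem R s).choose : S) * lam.toFun s

/-- Any left unit of `s` in `R` may be used to compute `λ̂(s)`: two of them are dominated by a
common one, over which `λ⁻¹` is right `R`-linear. -/
theorem hatFun_eq (lam : AutSR R) {s e : S} (he : e ∈ R) (hes : e * s = s) :
    lam.hatFun s = lam⁻¹.toFun e * lam.toFun s := by
  obtain ⟨f, hf, ⟨h₁, -⟩, ⟨h₂, -⟩⟩ :=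
    exists_unit_mem₂ R ((exists_unit_mem R s).choose : S) e
  rw [hatFun, lam.inv_mul_eq_of_unit (SetLike.coe_mem _) (exists_unit_mem R s).choose_spec.1 h₁,
    lam.inv_mul_eq_of_unit he hes h₂]

/-- The ring endomorphism `λ̂`. -/
noncomputable def hatHom (lam : AutSR R) : endRings R where
  val :=
    { toFun := lam.hatFun
      map_zero' := by
        rw [lam.hatFun_eq (e := 0) (zero_mem R) (mul_zero _),
          show lam.toFun 0 = 0 from map_zero _, mul_zero]
      map_add' := fun s t => by
        obtain ⟨e, he, ⟨h₁, -⟩, ⟨h₂, -⟩⟩ := exists_unit_mem₂ R s t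
        rw [lam.hatFun_eq he h₁, lam.hatFun_eq he h₂,
          lam.hatFun_eq (s := s + t) he (by rw [mul_add, h₁, h₂]), lam.map_add, mul_add]
      map_mul' := fun s t => by
        obtain ⟨e, he, ⟨h₁, h₁'⟩, ⟨h₂, -⟩⟩ := exists_unit_mem₂ R s t
        rw [lam.hatFun_eq he h₁, lam.hatFun_eq he h₂,
          lam.hatFun_eq (s := s * t) he (by rw [← mul_assoc, h₁]), mul_assoc,
          ← mul_assoc (lam.toFun s), lam.mul_inv_apply_unit he h₁', map_left] }
  property := fun r hr => by
    obtain ⟨e, h₁, h₂⟩ := exists_unit_mem R r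
    change lam.hatFun r = r
    rw [lam.hatFun_eq e.2 h₁, ← h₂, map_left, ← mul_assoc, ← map_right _ _ hr, h₁, ← map_left,
      ← map_right _ _ e.2, h₂, apply_inv_self]

theorem hatFun_mul (lam mu : AutSR R) (s : S) :
    (lam * mu).hatFun s = lam.hatFun (mu.hatFun s) := by
  obtain ⟨e, h, -⟩ := exists_unit_mem R s
  obtain ⟨f, h', -⟩ := exists_unit_mem R (e : S)
  have h₁ := mu.hatFun_eq e.2 h
  have h₂ : (f : S) * mu.hatFun s = mu.hatFun s := by
    rw [h₁, ← mul_assoc, ← mu⁻¹.map_left, h']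
  rw [lam.hatFun_eq f.2 h₂, h₁, (lam * mu).hatFun_eq e.2 h, mul_inv_apply, lam.map_left,
    ← mul_assoc, ← mu⁻¹.map_left, ← lam⁻¹.map_right _ e.2, h']
  rfl

end AutSR

variable (R) in
/-- The homomorphism `λ ↦ λ̂`. -/
noncomputable def hatMonoidHom : AutSR R →* AutRings R :=
  MonoidHom.toHomUnits
    { toFun := AutSR.hatHom
      map_one' := Subtype.ext <| NonUnitalRingHom.ext fun s => by
        obtain ⟨e, h, -⟩ := exists_unit_mem R s
        exact ((1 : AutSR R).hatFun_eq e.2 h).trans h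
      map_mul' := fun lam mu =>
        Subtype.ext <| NonUnitalRingHom.ext fun s => lam.hatFun_mul mu s }

theorem hatMonoidHom_apply (lam : AutSR R) {s e : S} (he : e ∈ R) (hes : e * s = s) :
    (hatMonoidHom R lam).hom s = lam⁻¹.toFun e * lam.toFun s :=
  lam.hatFun_eq he hes

end AutSR

/-! ### The homomorphism `ℰ` -/

section twist
variable {S : Type u} [NonUnitalRing S] [LocalUnits S] {R : NonUnitalSubring S} [SameLocalUnits R]

theorem Skel.mk_eq_iff {U V : Obj R} : Skel.mk U = Skel.mk V ↔ Obj.Iso U V :=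
  ⟨fun h => Quotient.exact h, fun h => Quotient.sound h⟩

theorem twistClass_one : twistClass (1 : AutRings R) = 1 :=
  Skel.mk_eq_iff.2 ⟨.id _, .id _, .id _, ⟨fun _ _ => rfl, fun _ _ => rfl⟩,
    Function.bijective_id, Function.bijective_id, fun _ => rfl⟩

/-- The isomorphism `S_γ ⊗_S S_δ ≅ S_{γδ}` is `x ⊗ y ↦ x γ(y)`, the right action map of `S` on
`S_γ`. -/
theorem twistClass_mul (γ δ : AutRings R) :
    twistClass (γ * δ) = twistClass γ * twistClass δ := by
  let U := twistObj R γ.hom γ.hom_of_mem γ.bijective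
  let V := twistObj R δ.hom δ.hom_of_mem δ.bijective
  let X := twist R γ.hom γ.hom_of_mem
  let Y := twist R δ.hom δ.hom_of_mem
  let Z := twist R (γ * δ).hom (γ * δ).hom_of_mem
  let f : Tens X Y →+ Tens X (regular S) :=
    tmap X Y X (regular S) (.id _) (.id _) (fun _ _ => rfl) (fun _ _ => rfl)
  have hf : Function.Bijective f :=
    tmap_bijective _ _ _ _ _ _ _ _ Function.bijective_id Function.bijective_id
  let β : tensor X Y →+ Z := (actR X).comp f
  have hβ : IsBilinear β :=
    isBilinear_of_tmul β (fun a x y => mul_assoc a x (γ.hom y))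
      (fun t x y => by
        change x * γ.hom (y * δ.hom t) = x * γ.hom y * γ.hom (δ.hom t)
        rw [map_mul, mul_assoc])
  refine Eq.symm (Skel.mk_eq_iff.2 ⟨actL (regular R), β, actL_isBilinear _, hβ,
    actL_bijective _, (actR_bijective X).comp hf, fun z => ?_⟩)
  exact DFunLike.congr_fun (f := β.comp (chi U V)) (g := (incl R).comp (actL (regular R)))
    (tens_hom_ext fun (p q : R) => congrArg ((p : S) * ·) (γ.hom_of_mem q q.2)) z

variable (R) in
/-- The homomorphism `γ ↦ [R ⇒ S_γ]` to the monoid `𝒮(S/R)`. -/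
def twistHom : AutRings R →* Skel R where
  toFun := twistClass
  map_one' := twistClass_one
  map_mul' := twistClass_mul

theorem isUnit_twistClass (γ : AutRings R) : IsUnit (twistClass γ) :=
  (Group.isUnit γ).map (twistHom R)

theorem mem_PSR_of_isUnit {x : Skel R} (hx : IsUnit x) : x ∈ PSR R :=
  ⟨hx.map (classP R), hx.map (classX R)⟩

variable (R) in
/-- The homomorphism `γ ↦ [R ⇒ S_γ]` to `𝒫(S/R)`. -/
def twistPSR : AutRings R →* PSR R :=
  (twistHom R).codRestrict (PSR R) fun γ => mem_PSR_of_isUnit (isUnit_twistClass γ)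

/-- An isomorphism of `R ⇒ S_γ` with `R ⇒ S` is determined by its component on `S_γ`, which
preserves `R`. -/
theorem twistClass_eq_one_iff_exists (γ : AutRings R) :
    twistClass γ = 1 ↔ ∃ β : S →+ S, Function.Bijective β ∧ (∀ s x, β (s * x) = s * β x) ∧
      (∀ x t, β (x * γ.hom t) = β x * t) ∧ β '' (R : Set S) = R := by
  constructor
  · intro h
    obtain ⟨α, β, hβ, hl, hγ, hα, hαβ⟩ : ∃ (α : R →+ R) (β : S →+ S), Function.Bijective β ∧
        (∀ s x, β (s * x) = s * β x) ∧ (∀ x t, β (x * γ.hom t) = β x * t) ∧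
        Function.Bijective α ∧ ∀ r : R, β r = α r := by
      obtain ⟨α, β, -, hβ, hαb, hβb, hαβ⟩ := (Skel.mk_eq_iff (V := Obj.one R)).1 h
      exact ⟨α, β, hβb, hβ.map_l, fun x t => hβ.map_r t x, hαb, hαβ⟩
    refine ⟨β, hβ, hl, hγ, Set.ext fun x => ⟨?_, fun hx => ?_⟩⟩
    · rintro ⟨r, hr, rfl⟩
      exact hαβ ⟨r, hr⟩ ▸ (α ⟨r, hr⟩).2
    · obtain ⟨r, hr⟩ := hα.2 ⟨x, hx⟩
      exact ⟨r, r.2, (hαβ r).trans (congrArg Subtype.val hr)⟩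
  · rintro ⟨β, hb, hl, hγ, hR⟩
    have hmem : ∀ r : R, β r ∈ R := fun r => hR.subset ⟨r, r.2, rfl⟩
    let α : R →+ R := (β.comp (incl R)).codRestrict R hmem
    have hα₁ : ∀ a x : R, α (a * x) = a * α x := fun a x => Subtype.ext (hl a x)
    have hα₂ : ∀ a x : R, α (x * a) = α x * a := fun a x => Subtype.ext <| by
      have := hγ x a
      rwa [γ.hom_of_mem a a.2] at this
    have hαb : Function.Bijective α := by
      refine ⟨fun x y h => Subtype.ext (hb.1 (congrArg Subtype.val h)), fun r => ?_⟩
      obtain ⟨x, hx, hxr⟩ := hR.superset r.2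
      exact ⟨⟨x, hx⟩, Subtype.ext hxr⟩
    exact (Skel.mk_eq_iff (V := Obj.one R)).2 ⟨α, β, ⟨hα₁, hα₂⟩, ⟨hl, fun t x => hγ x t⟩, hαb, hb,
      fun _ => rfl⟩

/-- The map `β` of `twistClass_eq_one_iff_exists` is the same thing as `λ⁻¹` for some `λ` with
`λ⁻¹(R) = R` and `λ̂ = γ`. -/
theorem twistClass_eq_one_iff (γ : AutRings R) :
    twistClass γ = 1 ↔ ∃ lam ∈ (invHom R).ker, hatMonoidHom R lam = γ := by
  rw [twistClass_eq_one_iff_exists]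
  constructor
  · rintro ⟨β, hb, hl, hγ, hR⟩
    obtain ⟨lam, hlam⟩ := AutSR.exists_inv_eq (R := R) β hb hl fun x r hr => by
      have := hγ x r
      rwa [γ.hom_of_mem r hr] at this
    refine ⟨lam, mem_ker_invHom.2 ((Set.image_congr fun x _ => hlam x).trans hR),
      Units.ext (Subtype.ext (NonUnitalRingHom.ext fun s => ?_))⟩
    change (hatMonoidHom R lam).hom s = γ.hom s
    obtain ⟨e, he, ⟨h₁, -⟩, ⟨h₂, -⟩⟩ := exists_unit_mem₂ R s (γ.hom s)
    have h₃ : lam⁻¹.toFun e * s = lam⁻¹.toFun (γ.hom s) := by rw [hlam, hlam, ← hγ, h₂]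
    rw [hatMonoidHom_apply lam he h₁, ← AutSR.map_left, h₃, AutSR.apply_inv_self]
  · rintro ⟨lam, hlam, rfl⟩
    refine ⟨((lam⁻¹ : AutSR R) : endSR R).1, lam⁻¹.bijective, lam⁻¹.map_left, fun x t => ?_,
      mem_ker_invHom.1 hlam⟩
    change lam⁻¹.toFun (x * (hatMonoidHom R lam).hom t) = lam⁻¹.toFun x * t
    obtain ⟨e, he, ⟨h₁, -⟩, ⟨-, h₂⟩⟩ := exists_unit_mem₂ R t x
    rw [hatMonoidHom_apply lam he h₁, ← mul_assoc, AutSR.map_left, AutSR.inv_apply_self,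
      ← AutSR.map_left, h₂]

/-! ### Objects `P ⇒ X` with `P ≅ R` -/

/-- An object `φ : R ⇒ X` determines `γ` by `φ(e) t = γ(t) φ(e)`: both `s ↦ s φ(e)` and
`s ↦ φ(e) s` are bijections `S → X`, and the first is an isomorphism `S_γ → X`. -/
theorem exists_twistClass_eq (U : Obj R) (h : Iso U.P (regular R)) :
    ∃ γ : AutRings R, twistClass γ = Skel.mk U := by
  obtain ⟨α, hα, hαb⟩ := h.symm
  let P := U.P
  let X := U.X
  let φ : R →+ X := U.φ.comp α
  have φ_l : ∀ a p : R, φ (a * p) = X.l (a : S) (φ p) := fun a p =>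
    (congrArg U.φ (hα.map_l a p)).trans (U.φ_l a (α p))
  have φ_r : ∀ a p : R, φ (p * a) = X.r (a : S) (φ p) := fun a p =>
    (congrArg U.φ (hα.map_r a p)).trans (U.φ_r a (α p))
  -- the maps `l : s ↦ s φ(e)` and `r : s ↦ φ(e) s`, written without `e`
  obtain ⟨l, hlb, hl⟩ : ∃ l : S →+ X, Function.Bijective l ∧
      ∀ (s : S) (p : R), l (s * p) = X.l s (φ p) := by
    obtain ⟨g, -, hgb, -, hg⟩ := (actR_isBilinear (resR R (regular S))).exists_inv
      (actR_bijective (resR R (regular S)))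
    let t := tmap (resR R (regular S)) (regular R) (resR R (regular S)) P (.id _) α
      (fun _ _ => rfl) hα.map_l
    have ht : Function.Bijective t :=
      tmap_bijective _ _ _ _ _ _ _ _ Function.bijective_id hαb
    refine ⟨(barL R U.φ U.φ_l).comp (t.comp g), U.bij_l.comp (ht.comp hgb), fun s p => ?_⟩
    have : g (s * p) = tmul (resR R (regular S)) (regular R) s p :=
      (actR_bijective (resR R (regular S))).1 (hg _)
    exact congrArg (fun z => barL R U.φ U.φ_l (t z)) this
  obtain ⟨r, hrb, hr⟩ : ∃ r : S →+ X, Function.Bijective r ∧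
      ∀ (s : S) (p : R), r (p * s) = X.r s (φ p) := by
    obtain ⟨g, -, hgb, -, hg⟩ := (actL_isBilinear (resL R (regular S))).exists_inv
      (actL_bijective (resL R (regular S)))
    let t := tmap (regular R) (resL R (regular S)) P (resL R (regular S)) α (.id _)
      hα.map_r (fun _ _ => rfl)
    have ht : Function.Bijective t :=
      tmap_bijective _ _ _ _ _ _ _ _ hαb Function.bijective_id
    refine ⟨(barR R U.φ U.φ_r).comp (t.comp g), U.bij_r.comp (ht.comp hgb), fun s p => ?_⟩
    have : g (p * s) = tmul (regular R) (resL R (regular S)) p s :=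
      (actL_bijective (resL R (regular S))).1 (hg _)
    exact congrArg (fun z => barR R U.φ U.φ_r (t z)) this
  have lφ : ∀ p : R, l p = φ p := fun p => by
    obtain ⟨e, he, -⟩ := exists_unit₁ p
    have := hl e p
    rwa [← φ_l, he, show (e : S) * p = p from congrArg Subtype.val he] at this
  have rφ : ∀ p : R, r p = φ p := fun p => by
    obtain ⟨e, -, he⟩ := exists_unit₁ p
    have := hr e p
    rwa [← φ_r, he, show (p : S) * e = p from congrArg Subtype.val he] at this
  have l_mul : ∀ s t : S, l (s * t) = X.l s (l t) := fun s t => by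
    obtain ⟨e, -, he⟩ := exists_unit_mem R t
    rw [← he, ← mul_assoc, hl, hl, X.l_mul]
  have r_mul : ∀ s t : S, r (s * t) = X.r t (r s) := fun s t => by
    obtain ⟨e, he, -⟩ := exists_unit_mem R s
    rw [← he, mul_assoc, hr, hr, X.r_mul]
  let L := AddEquiv.ofBijective l hlb
  have hL : ∀ x, l (L.symm x) = x := L.apply_symm_apply
  -- `γ` is characterized by `l (γ t) = r t`
  let γ₀ : S →+ S := L.symm.toAddMonoidHom.comp r
  have hγ₀ : ∀ t, l (γ₀ t) = r t := fun t => hL _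
  have hγb : Function.Bijective γ₀ := L.symm.bijective.comp hrb
  have l_r : ∀ s t : S, l (s * γ₀ t) = X.r t (l s) := fun s t => by
    obtain ⟨e, he, ⟨-, h₁⟩, ⟨h₂, -⟩⟩ := exists_unit_mem₂ R s t
    have h₃ : r t = X.r t (φ ⟨e, he⟩) := by
      have := hr t ⟨e, he⟩
      rwa [h₂] at this
    have h₄ : l s = X.l s (φ ⟨e, he⟩) := by
      have := hl s ⟨e, he⟩
      rwa [h₁] at this
    rw [l_mul, hγ₀, h₃, h₄, X.l_r]
  let γ₁ : S →ₙ+* S :=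
    { γ₀ with
      map_mul' := fun s t => hlb.1 <| by
        change l (γ₀ (s * t)) = l (γ₀ s * γ₀ t)
        rw [l_r, hγ₀, hγ₀, r_mul] }
  have hγR : ∀ p ∈ R, γ₁ p = p := fun p hp => hlb.1 <| by
    change l (γ₀ p) = l p
    rw [hγ₀, lφ ⟨p, hp⟩, rφ ⟨p, hp⟩]
  let G := RingEquiv.ofBijective γ₁ hγb
  have h1 : ∀ x, G.symm (γ₁ x) = x := G.symm_apply_apply
  have h2 : ∀ x, γ₁ (G.symm x) = x := G.apply_symm_apply
  let γ : AutRings R :=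
    { val := ⟨γ₁, hγR⟩
      inv := ⟨(G.symm : S →ₙ+* S), fun p hp => by
        have := h1 p
        rwa [hγR p hp] at this⟩
      val_inv := Subtype.ext (NonUnitalRingHom.ext h2)
      inv_val := Subtype.ext (NonUnitalRingHom.ext h1) }
  exact ⟨γ, Skel.mk_eq_iff.2 ⟨α, l, hα, ⟨l_mul, fun t s => l_r s t⟩, hαb, hlb, lφ⟩⟩

end twist

/-! ### Morita contexts and inverses in `𝒮(S/R)` -/

section assoc
variable {A B C D : Type u} [NonUnitalRing A] [NonUnitalRing B] [NonUnitalRing C]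
  [NonUnitalRing D]

theorem assocInv_bijective (M : Bimod A B) (N : Bimod B C) (K : Bimod C D) :
    Function.Bijective (assocInv M N K) :=
  Function.bijective_iff_has_inverse.2 ⟨assocHom M N K,
    fun z => DFunLike.congr_fun (f := (assocHom M N K).comp (assocInv M N K))
      (g := AddMonoidHom.id _) (tens₃_hom_ext' fun _ _ _ => rfl) z,
    fun z => DFunLike.congr_fun (f := (assocInv M N K).comp (assocHom M N K))
      (g := AddMonoidHom.id _) (tens₃_hom_ext fun _ _ _ => rfl) z⟩

theorem assocInv_isBilinear (M : Bimod A B) (N : Bimod B C) (K : Bimod C D) :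
    IsBilinear (assocInv M N K) := by
  constructor
  · intro a x
    exact DFunLike.congr_fun (f := (assocInv M N K).comp ((tensor M (tensor N K)).l a))
      (g := ((tensor (tensor M N) K).l a).comp (assocInv M N K))
      (tens₃_hom_ext' fun _ _ _ => rfl) x
  · intro a x
    exact DFunLike.congr_fun (f := (assocInv M N K).comp ((tensor M (tensor N K)).r a))
      (g := ((tensor (tensor M N) K).r a).comp (assocInv M N K))
      (tens₃_hom_ext' fun _ _ _ => rfl) x

end assoc

section morita

/-- Adjusting one of two isomorphisms `M ⊗ N ≅ A ≅ N ⊗ M` by an automorphism of `M` makes them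
associative on `M ⊗ N ⊗ M`. -/
theorem exists_compatible_pairing {A : Type u} [NonUnitalRing A] [LocalUnits A]
    {M N : Bimod A A} {f : tensor M N →+ regular A} (hf : IsBilinear f)
    (hfb : Function.Bijective f) (h : Iso (tensor N M) (regular A)) :
    ∃ g : tensor N M →+ regular A, IsBilinear g ∧ Function.Bijective g ∧
      ∀ m n m', M.r (g (tmul N M n m')) m = M.l (f (tmul M N m n)) m' := by
  obtain ⟨g, hg, hgb⟩ := h
  -- the bijections `m ⊗ n ⊗ m' ↦ f(m, n) m'` and `m ⊗ n ⊗ m' ↦ m g(n, m')`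
  let a : tensor (tensor M N) M →+ M := (actL M).comp
    (tmap (tensor M N) M (regular A) M f (.id _) hf.map_r (fun _ _ => rfl))
  have ha : IsBilinear a := (actL_isBilinear M).comp (tmap_isBilinear hf (.id M))
  have hab : Function.Bijective a := (actL_bijective M).comp
    (tmap_bijective _ _ _ _ _ _ _ _ hfb Function.bijective_id)
  let b : tensor (tensor M N) M →+ M := ((actR M).comp
    (tmap M (tensor N M) M (regular A) (.id _) g (fun _ _ => rfl) hg.map_l)).comp
      (assocHom M N M)
  have hb : IsBilinear b := ((actR_isBilinear M).comp (tmap_isBilinear (.id M) hg)).comp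
    (assocHom_isBilinear M N M)
  have hbb : Function.Bijective b := ((actR_bijective M).comp
    (tmap_bijective _ _ _ _ _ _ _ _ Function.bijective_id hgb)).comp (assocHom_bijective M N M)
  obtain ⟨b', hb', hbb', h₃, -⟩ := hb.exists_inv hbb
  -- the automorphism `θ = a b⁻¹` of `M` satisfies `θ (m g(n, m')) = f(m, n) m'`
  let θ : M →+ M := a.comp b'
  have hθ : IsBilinear θ := ha.comp hb'
  have hθb : Function.Bijective θ := hab.comp hbb'
  have key : ∀ m n m', θ (M.r (g (tmul N M n m')) m) = M.l (f (tmul M N m n)) m' :=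
    fun m n m' => congrArg a (h₃ (tmul (tensor M N) M (tmul M N m n) m'))
  obtain ⟨θ', hθ', -, h₅, -⟩ := hθ.exists_inv hθb
  refine ⟨g.comp (tmap N M N M (.id _) θ (fun _ _ => rfl) hθ.map_l),
    hg.comp (tmap_isBilinear (.id N) hθ),
    hgb.comp (tmap_bijective _ _ _ _ _ _ _ _ Function.bijective_id hθb), fun m n m' => ?_⟩
  change M.r (g (tmul N M n (θ m'))) m = _
  rw [← h₅ (M.r _ m), key, hθ'.map_l, h₅]

variable {S : Type u} [NonUnitalRing S] [LocalUnits S] {R : NonUnitalSubring S} [SameLocalUnits R]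

theorem cmpR_isBilinear {B : Type u} [NonUnitalRing B] (U : Obj R) (Y : Bimod S B) :
    IsBilinear (N := resL R (tensor U.X Y)) (cmpR U Y) :=
  isBilinear_of_tmul (M := U.P) (N := resL R Y) (K := resL R (tensor U.X Y)) _
    (fun a p y => congrArg (fun t => tmul U.X Y t y) (U.φ_l a p)) (fun _ _ _ => rfl)

theorem cmpL_isBilinear {B : Type u} [NonUnitalRing B] (U : Obj R) (Y : Bimod B S) :
    IsBilinear (N := resR R (tensor Y U.X)) (cmpL U Y) :=
  isBilinear_of_tmul (M := resR R Y) (N := U.P) (K := resR R (tensor Y U.X)) _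
    (fun _ _ _ => rfl) (fun a y p => congrArg (tmul Y U.X y) (U.φ_r a p))

/-- If `Q` is inverse to `P` and `Y` to `X`, then `P ⇒ X` in `ℳ(S/R)` yields an object
`ψ : Q ⇒ Y`. With pairings `f, g` between `P, Q` and `F, G` between `X, Y`, the map `ψ` is
characterized by `F(φ(p), ψ(q)) = f(p, q)`. Compatibility of `f` with `g` identifies `Q ⊗_R S → Y`
with the bijection inverse to `g(q, p) y ↦ q ⊗ F(φ(p), y)`; compatibility of `F` with `G`
identifies `S ⊗_R Q → Y` with the bijection `G(y, φ(p)) ⊗ q ↦ y f(p, q)`. -/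
theorem exists_obj_of_inverses (U : Obj R) {Q : Bimod R R} {Y : Bimod S S}
    (hPQ : Iso (tensor U.P Q) (regular R)) (hQP : Iso (tensor Q U.P) (regular R))
    (hXY : Iso (tensor U.X Y) (regular S)) (hYX : Iso (tensor Y U.X) (regular S)) :
    ∃ V : Obj R, V.P = Q ∧ V.X = Y := by
  obtain ⟨f, hf, hfb⟩ := hPQ
  obtain ⟨g, hg, hgb, hfg⟩ := exists_compatible_pairing hf hfb hQP
  obtain ⟨G, hG, hGb⟩ := hYX
  obtain ⟨F, hF, hFb, hFG⟩ := exists_compatible_pairing hG hGb hXY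
  let P := U.P
  let X := U.X
  let φ := U.φ
  let SL := resL R (regular S)
  let SR := resR R (regular S)
  -- `a (q ⊗ (p ⊗ y)) = g(q, p) y` and `b (q ⊗ (p ⊗ y)) = q ⊗ F(φ(p), y)`
  let a : tensor Q (tensor P (resL R Y)) →+ resL R Y := ((actL (resL R Y)).comp
    (tmap (tensor Q P) (resL R Y) (regular R) (resL R Y) g (.id _) hg.map_r
      (fun _ _ => rfl))).comp (assocInv Q P (resL R Y))
  have hab : Function.Bijective a := ((actL_bijective _).comp
    (tmap_bijective _ _ _ _ _ _ _ _ hgb Function.bijective_id)).comp (assocInv_bijective _ _ _)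
  have ha : IsBilinear a := ((actL_isBilinear _).comp (tmap_isBilinear hg (.id _))).comp
    (assocInv_isBilinear _ _ _)
  let b₀ : tensor P (resL R Y) →+ SL := F.comp (cmpR U Y)
  have hb₀ : IsBilinear b₀ :=
    IsBilinear.comp (M := tensor P (resL R Y)) (N := resL R (tensor X Y)) (K := SL)
      ⟨fun r z => hF.map_l (r : S) z, hF.map_r⟩ (cmpR_isBilinear U Y)
  have hb₀b : Function.Bijective b₀ := hFb.comp (cmpR_bijective U Y)
  let b : tensor Q (tensor P (resL R Y)) →+ tensor Q SL :=
    tmap Q (tensor P (resL R Y)) Q SL (.id _) b₀ (fun _ _ => rfl) hb₀.map_l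
  have hb : IsBilinear b := tmap_isBilinear (.id Q) hb₀
  have hbb : Function.Bijective b :=
    tmap_bijective _ _ _ _ _ _ _ _ Function.bijective_id hb₀b
  obtain ⟨b', hb', hbb', h₁, -⟩ := hb.exists_inv hbb
  let T : tensor Q SL →+ resL R Y := a.comp b'
  have hT : IsBilinear T := ha.comp hb'
  have hTb : Function.Bijective T := hab.comp hbb'
  have T_apply : ∀ q p y, T (tmul Q SL q (F (tmul X Y (φ p) y))) = Y.l (g (tmul Q P q p) : R) y :=
    fun q p y => congrArg a (h₁ (tmul Q (tensor P (resL R Y)) q (tmul P (resL R Y) p y)))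
  -- `F(φ(p), T(q ⊗ s)) = f(p, q) s`
  have F_T : ∀ (p : P) (q : Q) (s : S),
      F (tmul X Y (φ p) (T (tmul Q SL q s))) = (f (tmul P Q p q) : R) * s := by
    intro p q s
    obtain ⟨z, rfl⟩ := hb₀b.2 s
    refine tens_congr (M := P) (N := resL R Y)
      (f := F.comp ((tmul X Y (φ p)).comp (T.comp ((tmul Q SL q).comp b₀))))
      (g := (AddMonoidHom.mulLeft ((f (tmul P Q p q) : R) : S)).comp b₀) (fun p' y => ?_) z
    calc F (tmul X Y (φ p) (T (tmul Q SL q (F (tmul X Y (φ p') y)))))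
        = F (tmul X Y (X.r ((g (tmul Q P q p') : R) : S) (φ p)) y) := by rw [T_apply, tmul_bal]
      _ = F (tmul X Y (X.l ((f (tmul P Q p q) : R) : S) (φ p')) y) := by
          rw [← U.φ_r, hfg, U.φ_l]
      _ = (f (tmul P Q p q) : R) * F (tmul X Y (φ p') y) := hF.map_l _ (tmul X Y (φ p') y)
  -- `ψ(q) = T(q ⊗ e)` whenever `q e = q`
  obtain ⟨c, -, -, -, hc⟩ := (actR_isBilinear Q).exists_inv (actR_bijective Q)
  let ψ : Q →+ Y := (T.comp (tmap Q (regular R) Q SL (.id _) (incl R) (fun _ _ => rfl)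
    (fun _ _ => rfl))).comp c
  have ψ_eq : ∀ (q : Q) (e : R), Q.r e q = q → ψ q = T (tmul Q SL q (e : S)) := by
    intro q e he
    have : c q = tmul Q (regular R) q e := (actR_bijective Q).1 ((hc q).trans he.symm)
    exact congrArg (fun z => T (tmap Q (regular R) Q SL (.id _) (incl R) (fun _ _ => rfl)
      (fun _ _ => rfl) z)) this
  have ψ_mul : ∀ (q : Q) (s : S), Y.r s (ψ q) = T (tmul Q SL q s) := by
    intro q s
    obtain ⟨e, he⟩ := exists_r_unit Q q
    have h₂ : tmul Q SL q ((e : S) * s) = tmul Q SL q s := by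
      have := tmul_bal Q SL q e s
      rw [he] at this
      exact this.symm
    rw [ψ_eq q e he, ← h₂]
    exact (hT.map_r s (tmul Q SL q (e : S))).symm
  have ψ_l : ∀ (r : R) q, ψ (Q.l r q) = Y.l (r : S) (ψ q) := by
    intro r q
    obtain ⟨e, he⟩ := exists_r_unit Q q
    rw [ψ_eq q e he, ψ_eq (Q.l r q) e (by rw [← Q.l_r, he])]
    exact hT.map_l r (tmul Q SL q (e : S))
  have ψ_r : ∀ (r : R) q, ψ (Q.r r q) = Y.r (r : S) (ψ q) := by
    intro r q
    obtain ⟨e, -, he⟩ := exists_unit₁ r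
    have h : tmul Q SL (Q.r r q) (e : S) = tmul Q SL q (r : S) :=
      (tmul_bal Q SL q r (e : S)).trans (congrArg (tmul Q SL q) (congrArg Subtype.val he))
    rw [ψ_eq (Q.r r q) e (by rw [← Q.r_mul, he]), ψ_mul, h]
  have F_ψ : ∀ (p : P) (q : Q), F (tmul X Y (φ p) (ψ q)) = ((f (tmul P Q p q) : R) : S) := by
    intro p q
    obtain ⟨e, he⟩ := exists_r_unit Q q
    rw [ψ_eq q e he, F_T]
    have h := hf.map_r e (tmul P Q p q)
    have h' : (tensor P Q).r e (tmul P Q p q) = tmul P Q p q := congrArg (tmul P Q p) he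
    exact congrArg Subtype.val (h.symm.trans (congrArg f h'))
  have hR : barR R ψ ψ_r = T := tens_hom_ext ψ_mul
  -- `a' ((y ⊗ p) ⊗ q) = y f(p, q)` and `b₁ ((y ⊗ p) ⊗ q) = G(y, φ(p)) ⊗ q`
  let a' : tensor (tensor (resR R Y) P) Q →+ resR R Y := ((actR (resR R Y)).comp
    (tmap (resR R Y) (tensor P Q) (resR R Y) (regular R) (.id _) f (fun _ _ => rfl)
      hf.map_l)).comp (assocHom (resR R Y) P Q)
  have ha' : Function.Bijective a' := ((actR_bijective _).comp
    (tmap_bijective _ _ _ _ _ _ _ _ Function.bijective_id hfb)).comp (assocHom_bijective _ _ _)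
  let b₁ : tensor (tensor (resR R Y) P) Q →+ tensor SR Q :=
    tmap (tensor (resR R Y) P) Q SR Q (G.comp (cmpL U Y)) (.id _)
      (fun r z => (congrArg G ((cmpL_isBilinear U Y).map_r r z)).trans
        (hG.map_r (r : S) (cmpL U Y z))) (fun _ _ => rfl)
  have hb₁ : Function.Bijective b₁ := tmap_bijective _ _ _ _ _ _ _ _
    (hGb.comp (cmpL_bijective U Y)) Function.bijective_id
  have hL : (barL R ψ ψ_l).comp b₁ = a' := tens₃_hom_ext fun y p q => by
    change Y.l (G (tmul Y X y (φ p))) (ψ q) = Y.r ((f (tmul P Q p q) : R) : S) y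
    rw [← hFG, F_ψ]
  have hL' : barL R ψ ψ_l ∘ b₁ = a' := funext fun z => DFunLike.congr_fun hL z
  exact ⟨⟨Q, Y, ψ, ψ_l, ψ_r, hR ▸ hTb,
    (Function.Bijective.of_comp_iff _ hb₁).1 (hL' ▸ ha')⟩, rfl, rfl⟩

/-- An element of `𝒮(S/R)` lying over `1` in `Pic R` is some `[R ⇒ S_γ]`, hence a unit. -/
theorem isUnit_of_classP_eq_one {x : Skel R} (hx : classP R x = 1) : IsUnit x := by
  obtain ⟨U, rfl⟩ := Quotient.exists_rep x
  obtain ⟨γ, hγ⟩ := exists_twistClass_eq U (Quotient.exact hx)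
  have h : IsUnit (Skel.mk U) := hγ ▸ isUnit_twistClass γ
  exact h

/-- Both products of `[P ⇒ X]` with the class of an object `Q ⇒ Y` lying over `[P]⁻¹` lie over `1`,
hence are units, so `[P ⇒ X]` has a left and a right inverse. -/
theorem isUnit_of_mem_PSR {x : Skel R} (hx : x ∈ PSR R) : IsUnit x := by
  obtain ⟨U, rfl⟩ := Quotient.exists_rep x
  obtain ⟨⟨u, hu⟩, ⟨v, hv⟩⟩ := hx
  obtain ⟨Q, hQ⟩ := Quotient.exists_rep (u⁻¹ : Pic R).val
  obtain ⟨Y, hY⟩ := Quotient.exists_rep (v⁻¹ : Pic S).val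
  have h₁ := u.mul_inv
  have h₂ := u.inv_mul
  have h₃ := v.mul_inv
  have h₄ := v.inv_mul
  rw [hu, ← hQ] at h₁ h₂
  rw [hv, ← hY] at h₃ h₄
  obtain ⟨V, rfl, -⟩ := exists_obj_of_inverses U (Quotient.exact h₁) (Quotient.exact h₂)
    (Quotient.exact h₃) (Quotient.exact h₄)
  have h₅ : IsUnit (Skel.mk U * Skel.mk V) := isUnit_of_classP_eq_one h₁
  have h₆ : IsUnit (Skel.mk V * Skel.mk U) := isUnit_of_classP_eq_one h₂
  obtain ⟨y, hy⟩ := h₅.exists_right_inv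
  obtain ⟨z, hz⟩ := h₆.exists_left_inv
  exact isUnit_iff_exists_and_exists.2 ⟨⟨_, (mul_assoc _ _ _).symm.trans hy⟩,
    ⟨_, (mul_assoc _ _ _).trans hz⟩⟩

end morita

end LURing

theorem mainTheorem5 {S : Type u} [NonUnitalRing S] [LocalUnits S]
    (R : NonUnitalSubring S) [SameLocalUnits R] :
    (∀ p : PSR R, IsUnit p) ∧
    ∃ (D : AutSR R →* InvR R) (hat : AutSR R →* AutRings R)
      (𝓔 : AutRings R →* PSR R) (𝓞l : PSR R →* Pic R),
      (∀ lam : AutSR R, ((D lam : SubBimod R).toAddSubgroup : Set S) = lam⁻¹.toFun '' (R : Set S)) ∧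
      (∀ (lam : AutSR R) (s : S), ∀ e ∈ unitsOf s,
        (hat lam).hom s = lam⁻¹.toFun e * s * lam.toFun e) ∧
      (∀ γ : AutRings R, (𝓔 γ : Skel R) = twistClass γ) ∧
      (∀ (U : Obj R) (hU : Skel.mk U ∈ PSR R), (𝓞l ⟨Skel.mk U, hU⟩ : IsoClass R) = IsoClass.mk U.P) ∧
      Function.Injective (Subgroup.inclusion (inf_le_left : D.ker ⊓ hat.ker ≤ D.ker)) ∧
      Function.MulExact (Subgroup.inclusion (inf_le_left : D.ker ⊓ hat.ker ≤ D.ker))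
        (hat.comp D.ker.subtype) ∧
      Function.MulExact (hat.comp D.ker.subtype) 𝓔 ∧
      Function.MulExact 𝓔 𝓞l := by
  have hu : ∀ p : PSR R, IsUnit p := fun p => by
    obtain ⟨u, hu⟩ := isUnit_of_mem_PSR p.2
    -- units of `𝒮(S/R)` lie in `𝒫(S/R)`, so an inverse in `𝒮(S/R)` is one in `𝒫(S/R)`
    have hmem : (↑u⁻¹ : Skel R) ∈ PSR R := mem_PSR_of_isUnit u⁻¹.isUnit
    exact isUnit_iff_exists.2 ⟨⟨_, hmem⟩,
      Subtype.ext (hu ▸ u.mul_inv : (p : Skel R) * ↑u⁻¹ = 1),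
      Subtype.ext (hu ▸ u.inv_mul : ↑u⁻¹ * (p : Skel R) = 1)⟩
  refine ⟨hu, invHom R, hatMonoidHom R, twistPSR R,
    IsUnit.liftRight ((classP R).comp (PSR R).subtype) fun p => (hu p).map _,
    fun _ => rfl, fun lam s e he => ?_, fun _ => rfl, fun _ _ => rfl,
    Subgroup.inclusion_injective _, fun lam => ?_, fun γ => ?_, fun p => ?_⟩
  · rw [hatMonoidHom_apply lam (SameLocalUnits.mem e he.1) he.2.1, mul_assoc, ← lam.map_left s,
      he.2.2]
  · exact ⟨fun h => ⟨⟨lam, lam.2, h⟩, rfl⟩, by rintro ⟨mu, rfl⟩; exact mu.2.2⟩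
  · rw [Subtype.ext_iff]
    exact (twistClass_eq_one_iff γ).trans
      ⟨fun ⟨lam, h, h'⟩ => ⟨⟨lam, h⟩, h'⟩, fun ⟨lam, h⟩ => ⟨lam, lam.2, h⟩⟩
  · rw [Units.ext_iff]
    change classP R p = 1 ↔ _
    obtain ⟨x, hx⟩ := p
    obtain ⟨U, rfl⟩ := Quotient.exists_rep x
    constructor
    · intro h
      obtain ⟨γ, hγ⟩ := exists_twistClass_eq U (Quotient.exact h)
      exact ⟨γ, Subtype.ext hγ⟩
    · rintro ⟨γ, hγ⟩
      -- the first component of `R ⇒ S_γ` is `R`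
      rw [← hγ]
      rfl
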